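/- Let $\Omega\subset\mathbb{R}^2$ be a bounded convex domain (non-empty, open) with $C^1$ boundary, let $|\partial\Omega|$ be the length of its boundary, and let $\{x\}=x-\lfloor x\rfloor$. Consider 1-rectifiable sets $\mathcal{L}\subset\overline{\Omega}$ whose points may be counted with multiplicity, so that several copies of the same curve are allowed: such a set is given by a multiplicity function $\theta:\mathbb{R}^2\to\mathbb{N}_0$ that is measurable with respect to the one-dimensional Hausdorff measure $\mathcal{H}^1$, vanishes outside $\overline{\Omega}$, and whose support $\{\theta\neq 0\}$ is, up to an $\mathcal{H}^1$-null set, covered by countably many Lipschitz curves. Its length is $|\mathcal{L}|=\int\theta\,d\mathcal{H}^1$ and its number of intersections with a line $\ell$ is $n_\ell(\mathcal{L})=\sum_{x\in\ell}\theta(x)$. Let $\mu$ be the kinematic measure $d\phi\,dp$ on the lines $\{x: x_1\cos\phi+x_2\sin\phi=p\}$ with $\phi\in[0,2\pi)$, $p\in\mathbb{R}$ (each line is counted once for each orientation, so that Crofton's formula reads $|\mathcal{L}|=\frac14\int n_\ell(\mathcal{L})\,d\mu(\ell)$). For $L\ge 0$ let $$E_\Omega(L)=\inf_{|\mathcal{L}|=L}\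 \frac14\int n_\ell(\mathcal{L})^2\,d\mu(\ell),$$ the infimum being taken over all such $\mathcal{L}$ of length $L$. Then, for every $L\ge 0$, $E_\Omega(L)$ is finite and $$\frac{|\partial\Omega|}{2}\left\{\frac{2L}{|\partial\Omega|}\right\}\left(1-\left\{\frac{2L}{|\partial\Omega|}\right\}\right)\ \le\ E_\Omega(L)-\frac{2L^2}{|\partial\Omega|}\ \le\ \frac{|\partial\Omega|}{4}.$$ If moreover $n|\partial\Omega|\le L\le n|\partial\Omega|+\operatorname{diam}(\Omega)$ for some integer $n\ge 0$, then the lower bound is an equality; in that case there are line segments in $\overline{\Omega}$ of length $L-n|\partial\Omega|$, and for every such segment the union of $n$ copies of $\partial\Omega$ and the segment (counted with multiplicity) has length $L$ and attains the infimum $E_\Omega(L)$. -/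

import Mathlib

open MeasureTheory Set
open scoped ENNReal Topology

noncomputable section

/-- The Euclidean plane. -/
abbrev Plane : Type := EuclideanSpace ℝ (Fin 2)

/-- The boundary of the open set `Ω` is of class `C¹`: near each boundary point, `Ω` is the sublevel
set `{g < 0}` of a `C¹` function `g` with non-vanishing derivative at that point. -/
def HasC1Boundary (Ω : Set Plane) : Prop :=
  ∀ p ∈ frontier Ω, ∃ (U : Set Plane) (g : Plane → ℝ), IsOpen U ∧ p ∈ U ∧
    ContDiffOn ℝ 1 g U ∧ fderiv ℝ g p ≠ 0 ∧ Ω ∩ U = {x ∈ U | g x < 0}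

/-- The length `|∂Ω|` of the boundary, i.e. its one-dimensional Hausdorff measure. -/
def boundaryLength (Ω : Set Plane) : ℝ := (μH[1] (frontier Ω)).toReal

/-- A 1-rectifiable set: measurable for the one-dimensional Hausdorff measure `μH[1]`, and covered,
up to a `μH[1]`-null set, by countably many Lipschitz curves. -/
def IsOneRectifiable (S : Set Plane) : Prop :=
  NullMeasurableSet S (μH[1] : Measure Plane) ∧
    ∃ f : ℕ → ℝ → Plane, (∀ i, ∃ K, LipschitzWith K (f i)) ∧
      (μH[1] : Measure Plane) (S \ ⋃ i, range (f i)) = 0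

/-- A 1-rectifiable set whose points are counted with multiplicity (so that several copies of the
same curve may be used) is described by its multiplicity function `θ : Plane → ℕ`. An ordinary set
is the case in which `θ` is its indicator function. -/
def IsOneRectifiableMultiset (θ : Plane → ℕ) : Prop :=
  NullMeasurable θ (μH[1] : Measure Plane) ∧ IsOneRectifiable {x | θ x ≠ 0}

/-- The length, counted with multiplicity. -/
def multisetLength (θ : Plane → ℕ) : ℝ≥0∞ := ∫⁻ x, (θ x : ℝ≥0∞) ∂(μH[1] : Measure Plane)

/-- The line with unit normal `(cos φ, sin φ)` and signed distance `p` from the origin,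
where `q = (φ, p)`. -/
def lineOf (q : ℝ × ℝ) : Set Plane := {x | x 0 * Real.cos q.1 + x 1 * Real.sin q.1 = q.2}

/-- The kinematic measure `dφ dp` on lines, `φ ∈ [0, 2π)`, `p ∈ ℝ`. Each line occurs for two
values of `(φ, p)`, one for each orientation; this is the normalization for which Crofton's formula
has the factor `1/4`. -/
def kinematicMeasure : Measure (ℝ × ℝ) :=
  (volume.restrict (Ico 0 (2 * Real.pi))).prod volume

/-- The number of intersections, with multiplicity, of `θ` with the line given by `q`. -/
def intersectionNumber (θ : Plane → ℕ) (q : ℝ × ℝ) : ℝ≥0∞ :=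
  ∑' x : lineOf q, (θ x : ℝ≥0∞)

/-- The energy: a quarter of the integral of the squared intersection number over all lines. -/
def croftonEnergy (θ : Plane → ℕ) : ℝ≥0∞ :=
  (∫⁻ q, intersectionNumber θ q ^ 2 ∂kinematicMeasure) / 4

/-- The competitors: 1-rectifiable sets (with multiplicity) of length `L` in the closure of `Ω`. -/
def IsCompetitor (Ω : Set Plane) (L : ℝ) (θ : Plane → ℕ) : Prop :=
  IsOneRectifiableMultiset θ ∧ {x | θ x ≠ 0} ⊆ closure Ω ∧ multisetLength θ = ENNReal.ofReal L

/-- The minimal energy `E_Ω(L)`. -/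
def minEnergy (Ω : Set Plane) (L : ℝ) : ℝ≥0∞ :=
  ⨅ (θ : Plane → ℕ) (_ : IsCompetitor Ω L θ), croftonEnergy θ

/-- The union of `n` copies of `∂Ω` and the line segment from `a` to `b`, with multiplicity. -/
def copiesWithSegment (Ω : Set Plane) (n : ℕ) (a b : Plane) : Plane → ℕ :=
  fun x => n * (frontier Ω).indicator 1 x + (segment ℝ a b).indicator 1 x

end

/-!
The intersection number `m` of a competitor with a line is an integer, so
`(2 * k + 1) * m ≤ m ^ 2 + k * (k + 1)` for every `k`, with equality exactly for `m = k` and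
`m = k + 1`. The lines that meet `Ω` have measure `2 * |∂Ω|`, and `4 * L ≤ ∫ m` by Crofton's
formula, of which only this inequality is needed: it can be checked on almost linear pieces of
curves. Integration bounds the energy below by `(2 * k + 1) * L - k * (k + 1) * |∂Ω| / 2`, and the
best choice of `k` is the floor of `2 * L / |∂Ω|`. A generic line that meets `Ω` hits `∂Ω` twice and
a segment at most once, so `n` copies of `∂Ω` and a segment attain the case `k = 2 * n`.

For the upper bound, write `L = n * |∂Ω| + r` with `0 ≤ r < |∂Ω|` and add to `n` copies of `∂Ω` a
set `A ⊆ ∂Ω` of length `r`. Its energy exceeds `2 * n ^ 2 * |∂Ω| + (4 * n + 1) * r` by half the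
measure of the lines that meet `∂Ω` only inside `A`. Cut `∂Ω` into `N` arcs of equal length. By
Cauchy's formula for the perimeter, applied to the inscribed polygon, lines that meet a single arc
twice have measure `O(1 / N)`, and by averaging one can choose about `N * r / |∂Ω|` arcs such that
the lines that meet two of them have measure at most about `2 * |∂Ω| * (r / |∂Ω|) ^ 2`. Hence the
minimal energy is at most `2 * n ^ 2 * |∂Ω| + (4 * n + 1) * r + r ^ 2 / |∂Ω|`, which is
`2 * L ^ 2 / |∂Ω| + |∂Ω| / 4 - (r - |∂Ω| / 2) ^ 2 / |∂Ω|`.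
-/

open Filter
open scoped NNReal

/-! ### Lines in the plane and the kinematic measure -/

/-- The unit vector at angle `t`. -/
noncomputable def unitVec (t : ℝ) : Plane := !₂[Real.cos t, Real.sin t]

@[simp] lemma unitVec_zero_apply (t : ℝ) : unitVec t 0 = Real.cos t := rfl

@[simp] lemma unitVec_one_apply (t : ℝ) : unitVec t 1 = Real.sin t := rfl

lemma Plane.norm_sq (x : Plane) : ‖x‖ ^ 2 = x 0 ^ 2 + x 1 ^ 2 := by
  simp [EuclideanSpace.norm_sq_eq, Fin.sum_univ_two]

lemma norm_unitVec (t : ℝ) : ‖unitVec t‖ = 1 := by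
  rw [← sq_eq_sq₀ (norm_nonneg _) zero_le_one, Plane.norm_sq]
  simp

lemma unitVec_ne_zero (t : ℝ) : unitVec t ≠ 0 := by
  simp [← norm_pos_iff, norm_unitVec]

lemma exists_eq_norm_smul_unitVec (v : Plane) : ∃ t, v = ‖v‖ • unitVec t := by
  have hn : ‖(⟨v 0, v 1⟩ : ℂ)‖ = ‖v‖ := by
    rw [← sq_eq_sq₀ (norm_nonneg _) (norm_nonneg _), Complex.sq_norm, Plane.norm_sq,
      Complex.normSq_apply, sq, sq]
  refine ⟨Complex.arg ⟨v 0, v 1⟩, ?_⟩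
  ext i
  fin_cases i
  · simp [← hn, Complex.norm_mul_cos_arg]
  · simp [← hn, Complex.norm_mul_sin_arg]

/-- The coordinate `x₁ cos φ + x₂ sin φ` along the normal direction `φ`, as a linear functional:
the lines with parameters `(φ, p)` are its level sets. -/
noncomputable def normalCoord (φ : ℝ) : Plane →L[ℝ] ℝ := innerSL ℝ (unitVec φ)

lemma normalCoord_apply (φ : ℝ) (x : Plane) :
    normalCoord φ x = x 0 * Real.cos φ + x 1 * Real.sin φ := by
  simp [normalCoord, PiLp.inner_apply, Fin.sum_univ_two]

lemma mem_lineOf {q : ℝ × ℝ} {x : Plane} : x ∈ lineOf q ↔ normalCoord q.1 x = q.2 := by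
  rw [normalCoord_apply]
  rfl

lemma norm_normalCoord (φ : ℝ) : ‖normalCoord φ‖ = 1 := by
  rw [normalCoord, innerSL_apply_norm, norm_unitVec]

lemma abs_normalCoord_le (φ : ℝ) (x : Plane) : |normalCoord φ x| ≤ ‖x‖ := by
  simpa [norm_normalCoord] using (normalCoord φ).le_opNorm x

lemma lipschitzWith_normalCoord (φ : ℝ) : LipschitzWith 1 (normalCoord φ) :=
  (normalCoord φ).lipschitzWith_of_opNorm_le (norm_normalCoord φ).le

lemma continuous_normalCoord_uncurry : Continuous fun z : ℝ × Plane => normalCoord z.1 z.2 := by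
  simp only [normalCoord_apply]
  fun_prop

/-- The parameters of the lines that meet `A`. -/
def linesMeeting (A : Set Plane) : Set (ℝ × ℝ) := {q | ∃ x ∈ A, normalCoord q.1 x = q.2}

lemma linesMeeting_mono {A B : Set Plane} (h : A ⊆ B) : linesMeeting A ⊆ linesMeeting B :=
  fun _ ⟨x, hx, hq⟩ => ⟨x, h hx, hq⟩

lemma linesMeeting_iUnion {ι : Sort*} (A : ι → Set Plane) :
    linesMeeting (⋃ i, A i) = ⋃ i, linesMeeting (A i) := by
  ext q
  simp only [linesMeeting, mem_iUnion, mem_ofPred_eq]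
  exact ⟨fun ⟨x, ⟨i, hi⟩, h⟩ => ⟨i, x, hi, h⟩, fun ⟨i, x, hi, h⟩ => ⟨x, ⟨i, hi⟩, h⟩⟩

lemma linesMeeting_union (A B : Set Plane) :
    linesMeeting (A ∪ B) = linesMeeting A ∪ linesMeeting B := by
  simp only [union_eq_iUnion, linesMeeting_iUnion, Bool.apply_cond linesMeeting]

lemma section_linesMeeting (φ : ℝ) (A : Set Plane) :
    Prod.mk φ ⁻¹' linesMeeting A = normalCoord φ '' A := rfl

lemma isClosed_linesMeeting {K : Set Plane} (hK : IsCompact K) : IsClosed (linesMeeting K) := by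
  have : CompactSpace K := isCompact_iff_compactSpace.1 hK
  have hc : IsClosed {z : (ℝ × ℝ) × K | normalCoord z.1.1 z.2 = z.1.2} :=
    isClosed_eq (continuous_normalCoord_uncurry.comp
      (f := fun z : (ℝ × ℝ) × K => (z.1.1, (z.2 : Plane))) (by fun_prop)) (by fun_prop)
  convert isClosedMap_fst_of_compactSpace _ hc using 1
  ext q
  simp [linesMeeting]

lemma measurableSet_linesMeeting {K : Set Plane} (hK : IsSigmaCompact K) :
    MeasurableSet (linesMeeting K) := by
  obtain ⟨C, hC, rfl⟩ := hK
  rw [linesMeeting_iUnion]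
  exact MeasurableSet.iUnion fun i => (isClosed_linesMeeting (hC i)).measurableSet

lemma kinematicMeasure_apply {E : Set (ℝ × ℝ)} (hE : MeasurableSet E) :
    kinematicMeasure E = ∫⁻ φ in Ico 0 (2 * Real.pi), volume (Prod.mk φ ⁻¹' E) :=
  Measure.prod_apply hE

lemma lintegral_section_le_kinematicMeasure (E : Set (ℝ × ℝ)) :
    ∫⁻ φ in Ico 0 (2 * Real.pi), volume (Prod.mk φ ⁻¹' E) ≤ kinematicMeasure E := by
  rw [← measure_toMeasurable E, kinematicMeasure_apply (measurableSet_toMeasurable _ _)]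
  exact lintegral_mono fun φ => measure_mono (preimage_mono (subset_toMeasurable _ _))

lemma setLIntegral_const_angle (c : ℝ≥0∞) :
    ∫⁻ _ in Ico 0 (2 * Real.pi), c = c * ENNReal.ofReal (2 * Real.pi) := by
  simp

lemma kinematicMeasure_linesMeeting_le_ediam (A : Set Plane) :
    kinematicMeasure (linesMeeting A) ≤ ENNReal.ofReal (2 * Real.pi) * Metric.ediam A := by
  rcases eq_or_ne (Metric.ediam A) ⊤ with h | h
  · rw [h, ENNReal.mul_top (by simp [Real.pi_pos])]
    exact le_top
  have hK : IsCompact (closure A) := (Metric.isBounded_iff_ediam_ne_top.2 h).isCompact_closure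
  calc kinematicMeasure (linesMeeting A)
      ≤ kinematicMeasure (linesMeeting (closure A)) :=
        measure_mono (linesMeeting_mono subset_closure)
    _ = ∫⁻ φ in Ico 0 (2 * Real.pi), volume (normalCoord φ '' closure A) :=
        kinematicMeasure_apply (isClosed_linesMeeting hK).measurableSet
    _ ≤ ∫⁻ _ in Ico 0 (2 * Real.pi), Metric.ediam A := by
        refine lintegral_mono fun φ => (Real.volume_le_diam _).trans ?_
        simpa using (lipschitzWith_normalCoord φ).ediam_image_le (closure A)
    _ = _ := by rw [setLIntegral_const_angle, mul_comm]

lemma outerMeasure_le_const_mul_hausdorffMeasure {X : Type*} [EMetricSpace X] [MeasurableSpace X]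
    [BorelSpace X] {m : OuterMeasure X} {C : ℝ≥0∞} (hC0 : C ≠ 0) (hC : C ≠ ⊤) {d : ℝ}
    (hm : ∀ s, m s ≤ C * Metric.ediam s ^ d) (s : Set X) : m s ≤ C * μH[d] s := by
  have h := OuterMeasure.le_mkMetric (C • fun r => r ^ d) m 1 one_pos fun s _ => hm s
  rw [OuterMeasure.mkMetric_smul _ hC hC0, ← Measure.mkMetric_toOuterMeasure] at h
  exact h s

lemma kinematicMeasure_linesMeeting_le_hausdorffMeasure (A : Set Plane) :
    kinematicMeasure (linesMeeting A) ≤ ENNReal.ofReal (2 * Real.pi) * μH[1] A := by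
  let m : OuterMeasure Plane :=
    { measureOf := fun A => kinematicMeasure (linesMeeting A)
      empty := by simp [linesMeeting]
      mono := fun h => measure_mono (linesMeeting_mono h)
      iUnion_nat := fun s _ => by rw [linesMeeting_iUnion]; exact measure_iUnion_le _ }
  refine outerMeasure_le_const_mul_hausdorffMeasure (m := m) (by simp [Real.pi_pos])
    ENNReal.ofReal_ne_top (fun A => ?_) A
  rw [ENNReal.rpow_one]
  exact kinematicMeasure_linesMeeting_le_ediam A

lemma kinematicMeasure_linesMeeting_eq_zero {N : Set Plane} (hN : μH[1] N = 0) :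
    kinematicMeasure (linesMeeting N) = 0 := by
  simpa [hN] using kinematicMeasure_linesMeeting_le_hausdorffMeasure N

lemma exists_isSigmaCompact_subset {X : Type*} [MetricSpace X] [CompleteSpace X]
    [SecondCountableTopology X] [MeasurableSpace X] [BorelSpace X] {μ : Measure X} {A : Set X}
    (hA : NullMeasurableSet A μ) (hfin : μ A ≠ ⊤) :
    ∃ K ⊆ A, IsSigmaCompact K ∧ μ (A \ K) = 0 := by
  obtain ⟨B, hBA, hB, hAB⟩ := hA.exists_measurable_subset_ae_eq
  have hBfin : μ B ≠ ⊤ := measure_ne_top_of_subset hBA hfin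
  have : IsFiniteMeasure (μ.restrict B) := ⟨by simpa using hBfin.lt_top⟩
  have hinner : ∀ n : ℕ, ∃ C ⊆ B, IsCompact C ∧ μ.restrict B (B \ C) < (n : ℝ≥0∞)⁻¹ := fun n =>
    hB.exists_isCompact_sdiff_lt (measure_ne_top _ _) (by simp)
  choose C hCB hC hlt using hinner
  refine ⟨⋃ n, C n, (iUnion_subset hCB).trans hBA, isSigmaCompact_iUnion_of_isCompact C hC, ?_⟩
  have hBC : μ (B \ ⋃ n, C n) = 0 := by
    refine le_antisymm (ge_of_tendsto' ENNReal.tendsto_inv_nat_nhds_zero fun n => ?_) zero_le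
    have hn := (hlt n).le
    rw [Measure.restrict_apply' hB, inter_eq_left.2 sdiff_subset] at hn
    exact (measure_mono (sdiff_subset_sdiff_right (subset_iUnion C n))).trans hn
  refine measure_mono_null (fun x hx => ?_) (measure_union_null hBC (ae_le_set.1 hAB.symm.le))
  exact (em (x ∈ B)).imp (fun hxB => ⟨hxB, hx.2⟩) fun hxB => ⟨hx.1, hxB⟩

lemma nullMeasurableSet_linesMeeting {A : Set Plane} (hA : NullMeasurableSet A (μH[1]))
    (hfin : μH[1] A ≠ ⊤) : NullMeasurableSet (linesMeeting A) kinematicMeasure := by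
  obtain ⟨K, hKA, hK, h0⟩ := exists_isSigmaCompact_subset hA hfin
  rw [← union_sdiff_cancel hKA, linesMeeting_union]
  exact (measurableSet_linesMeeting hK).nullMeasurableSet.union
    (NullMeasurableSet.of_null (kinematicMeasure_linesMeeting_eq_zero h0))

lemma integral_abs_cos_add_two_pi (a : ℝ) : ∫ φ in a..a + 2 * Real.pi, |Real.cos φ| = 4 := by
  have hper : Function.Periodic (fun φ => |Real.cos φ|) Real.pi := fun φ => by
    simp [Real.cos_add_pi]
  have hint (s t : ℝ) : IntervalIntegrable (fun φ => |Real.cos φ|) volume s t :=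
    Real.continuous_cos.abs.intervalIntegrable s t
  have hhalf : ∫ φ in -(Real.pi / 2)..Real.pi / 2, |Real.cos φ| = 2 := by
    rw [intervalIntegral.integral_congr (g := Real.cos) fun φ hφ => ?_]
    · simp; norm_num
    · rw [uIcc_of_le (by linarith [Real.pi_pos])] at hφ
      exact abs_of_nonneg (Real.cos_nonneg_of_mem_Icc hφ)
  have htwo := hper.intervalIntegral_add_zsmul_eq 2 a hint
  have hshift := hper.intervalIntegral_add_eq a (-(Real.pi / 2))
  rw [show -(Real.pi / 2) + Real.pi = Real.pi / 2 by ring, hhalf] at hshift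
  rw [hshift] at htwo
  norm_num at htwo
  exact htwo

lemma lintegral_abs_normalCoord (v : Plane) :
    ∫⁻ φ in Ico 0 (2 * Real.pi), ENNReal.ofReal |normalCoord φ v| = ENNReal.ofReal (4 * ‖v‖) := by
  obtain ⟨α, hα⟩ := exists_eq_norm_smul_unitVec v
  have hcos (φ : ℝ) : |normalCoord φ v| = ‖v‖ * |Real.cos (φ - α)| := by
    conv_lhs => rw [hα]
    rw [map_smul, smul_eq_mul, abs_mul, abs_norm, normalCoord_apply, unitVec_zero_apply,
      unitVec_one_apply, Real.cos_sub, mul_comm (Real.cos α), mul_comm (Real.sin α)]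
  have hc : Continuous fun φ => |normalCoord φ v| := by simp only [hcos]; fun_prop
  rw [← ofReal_integral_eq_lintegral_ofReal
    ((hc.integrableOn_Icc (a := 0) (b := 2 * Real.pi)).mono_set Ico_subset_Icc_self)
    (ae_of_all _ fun φ => abs_nonneg _), integral_Ico_eq_integral_Ioc,
    ← intervalIntegral.integral_of_le (by linarith [Real.pi_pos])]
  simp only [hcos]
  rw [intervalIntegral.integral_const_mul,
    intervalIntegral.integral_comp_sub_right (fun φ => |Real.cos φ|),
    show 2 * Real.pi - α = 0 - α + 2 * Real.pi by ring, integral_abs_cos_add_two_pi, mul_comm]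

lemma isCompact_segment {E : Type*} [AddCommGroup E] [Module ℝ E] [TopologicalSpace E]
    [IsTopologicalAddGroup E] [ContinuousSMul ℝ E] (a b : E) : IsCompact (segment ℝ a b) := by
  rw [← convexHull_pair]
  exact (toFinite _).isCompact_convexHull ℝ

lemma image_normalCoord_segment (φ : ℝ) (a b : Plane) :
    normalCoord φ '' segment ℝ a b = uIcc (normalCoord φ a) (normalCoord φ b) := by
  rw [← segment_eq_uIcc]
  exact image_segment ℝ (normalCoord φ).toLinearMap.toAffineMap a b

lemma kinematicMeasure_linesMeeting_segment (a b : Plane) :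
    kinematicMeasure (linesMeeting (segment ℝ a b)) = ENNReal.ofReal (4 * dist a b) := by
  rw [kinematicMeasure_apply (isClosed_linesMeeting (isCompact_segment a b)).measurableSet,
    dist_comm, dist_eq_norm, ← lintegral_abs_normalCoord]
  refine lintegral_congr fun φ => ?_
  rw [section_linesMeeting, image_normalCoord_segment, uIcc, Real.volume_Icc, map_sub,
    max_sub_min_eq_abs]

/-! ### Almost linear pieces of curves -/

section ApproximatesLinear

variable {F : Type*} [NormedAddCommGroup F] [NormedSpace ℝ F]

lemma norm_apply_eq_opNorm_mul_abs (A : ℝ →L[ℝ] F) (t : ℝ) : ‖A t‖ = ‖A‖ * |t| := by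
  rw [← A.toSpanSingleton_apply_map_one, ContinuousLinearMap.norm_toSpanSingleton,
    ContinuousLinearMap.toSpanSingleton_apply, norm_smul, Real.norm_eq_abs, mul_comm]

variable {f : ℝ → F} {A : ℝ →L[ℝ] F} {S : Set ℝ} {δ : ℝ≥0}

lemma mul_abs_sub_le_norm_sub_of_approximatesLinearOn (hf : ApproximatesLinearOn f A S δ)
    {x y : ℝ} (hx : x ∈ S) (hy : y ∈ S) : (‖A‖ - δ) * |x - y| ≤ ‖f x - f y‖ := by
  have hlin := hf x hx y hy
  have htri := norm_sub_norm_le (A (x - y)) (f x - f y)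
  rw [norm_sub_rev (A (x - y)), norm_apply_eq_opNorm_mul_abs] at htri
  rw [Real.norm_eq_abs] at hlin
  linarith

lemma injOn_of_approximatesLinearOn (hf : ApproximatesLinearOn f A S δ) (hδ : δ < ‖A‖) :
    InjOn f S := fun x hx y hy hxy => by
  have h := mul_abs_sub_le_norm_sub_of_approximatesLinearOn hf hx hy
  rw [hxy, sub_self, norm_zero] at h
  exact sub_eq_zero.1 (abs_eq_zero.1
    (le_antisymm (nonpos_of_mul_nonpos_right h (sub_pos.2 hδ)) (abs_nonneg _)))

variable [MeasurableSpace F] [BorelSpace F]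

lemma hausdorffMeasure_image_le_of_approximatesLinearOn (hf : ApproximatesLinearOn f A S δ) :
    μH[1] (f '' S) ≤ (‖A‖₊ + δ : ℝ≥0) * volume S := by
  simpa [hausdorffMeasure_real] using
    (lipschitzOnWith_iff_restrict.2 hf.lipschitz).hausdorffMeasure_image_le zero_le_one

lemma ofReal_mul_volume_le_of_approximatesLinearOn (hf : ApproximatesLinearOn f A S δ) :
    ENNReal.ofReal (‖A‖ - δ) * volume S ≤ μH[1] (f '' S) := by
  rcases le_or_gt (‖A‖ - δ) 0 with hk | hk
  · simp [ENNReal.ofReal_of_nonpos hk]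
  have hanti : AntilipschitzWith (Real.toNNReal (‖A‖ - δ)⁻¹) (S.domRestrict f) := by
    refine AntilipschitzWith.of_le_mul_dist fun x y => ?_
    rw [Real.coe_toNNReal _ (inv_nonneg.2 hk.le), inv_mul_eq_div, le_div_iff₀ hk, mul_comm,
      dist_eq_norm]
    exact mul_abs_sub_le_norm_sub_of_approximatesLinearOn hf x.2 y.2
  have hvol := hanti.le_hausdorffMeasure_image zero_le_one univ
  rw [← isometry_subtype_coe.hausdorffMeasure_image (Or.inl zero_le_one), image_univ,
    Subtype.range_coe, hausdorffMeasure_real, image_univ, range_domRestrict,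
    ENNReal.rpow_one] at hvol
  calc ENNReal.ofReal (‖A‖ - δ) * volume S
      ≤ ENNReal.ofReal (‖A‖ - δ) * (ENNReal.ofReal (‖A‖ - δ)⁻¹ * μH[1] (f '' S)) := by
        gcongr; exact hvol
    _ = μH[1] (f '' S) := by
        rw [← mul_assoc, ← ENNReal.ofReal_mul hk.le, mul_inv_cancel₀ hk.ne', ENNReal.ofReal_one,
          one_mul]

lemma hausdorffMeasure_image_eq_zero_of_hasDerivWithinAt_zero [SecondCountableTopology F]
    {s : Set ℝ} (hf : ∀ x ∈ s, HasDerivWithinAt f 0 s x) : μH[1] (f '' s) = 0 := by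
  rcases s.eq_empty_or_nonempty with rfl | hs
  · simp
  have hle : ∀ ε : ℝ≥0, ε ≠ 0 → ∀ u : Set ℝ, MeasurableSet u →
      μH[1] (f '' (s ∩ u)) ≤ ε * volume u := by
    intro ε hε u hu
    obtain ⟨t, A, hdisj, ht, hst, happ, hA⟩ :=
      exists_partition_approximatesLinearOn_of_hasFDerivWithinAt f s (fun _ => 0)
        (fun x hx => by simpa using (hf x hx).hasFDerivWithinAt) (fun _ => ε) (fun _ => hε)
    calc μH[1] (f '' (s ∩ u)) ≤ μH[1] (⋃ k, f '' (s ∩ t k ∩ u)) := by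
          rw [← image_iUnion, ← iUnion_inter, ← inter_iUnion, inter_eq_left.2 hst]
      _ ≤ ∑' k, μH[1] (f '' (s ∩ t k ∩ u)) := measure_iUnion_le _
      _ ≤ ∑' k, ε * volume (t k ∩ u) := by
          refine ENNReal.tsum_le_tsum fun k => ?_
          obtain ⟨-, -, hAk⟩ := hA hs k
          have hlen := hausdorffMeasure_image_le_of_approximatesLinearOn
            ((happ k).mono_set (inter_subset_left (t := u)))
          rw [hAk, nnnorm_zero, zero_add] at hlen
          exact hlen.trans (by gcongr; exact inter_subset_right)
      _ = ε * volume (⋃ k, t k ∩ u) := by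
          rw [ENNReal.tsum_mul_left, measure_iUnion
            (fun i j hij => (hdisj hij).mono inter_subset_left inter_subset_left)
            fun k => (ht k).inter hu]
      _ ≤ ε * volume u := by gcongr; exact iUnion_subset fun k => inter_subset_right
  have hfinite : ∀ n, μH[1] (f '' (s ∩ spanningSets volume n)) = 0 := fun n => by
    by_contra hne
    obtain ⟨ε, hε, hlt⟩ := ENNReal.exists_nnreal_pos_mul_lt
      (measure_spanningSets_lt_top (volume : Measure ℝ) n).ne hne
    exact (hle ε hε.ne' _ (measurableSet_spanningSets _ _)).not_gt hlt
  rw [← inter_univ s, ← iUnion_spanningSets (volume : Measure ℝ), inter_iUnion, image_iUnion]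
  exact measure_iUnion_null hfinite

end ApproximatesLinear

lemma ofReal_sub_le_lintegral_norm_normalCoord_comp (A : ℝ →L[ℝ] Plane) (δ : ℝ≥0) :
    ENNReal.ofReal (4 * ‖A‖ - 2 * Real.pi * δ) ≤
      ∫⁻ φ in Ico 0 (2 * Real.pi), ENNReal.ofReal (‖normalCoord φ ∘L A‖ - δ) := by
  have hnorm : ∀ φ, ‖normalCoord φ ∘L A‖ = |normalCoord φ (A 1)| := fun φ => by
    simpa using (norm_apply_eq_opNorm_mul_abs (normalCoord φ ∘L A) 1).symm
  have hA : ‖A‖ = ‖A 1‖ := by simpa using (norm_apply_eq_opNorm_mul_abs A 1).symm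
  rw [ENNReal.ofReal_sub _ (by positivity), tsub_le_iff_right, hA, ← lintegral_abs_normalCoord,
    mul_comm (2 * Real.pi), ENNReal.ofReal_mul δ.coe_nonneg, ← setLIntegral_const_angle,
    ← lintegral_add_right _ measurable_const]
  refine lintegral_mono fun φ => ?_
  rw [hnorm]
  exact (ENNReal.ofReal_le_ofReal (sub_add_cancel _ _).ge).trans ENNReal.ofReal_add_le

lemma mul_hausdorffMeasure_le_kinematicMeasure_of_approximatesLinearOn {f : ℝ → Plane}
    {A : ℝ →L[ℝ] Plane} {S : Set ℝ} {ε c : ℝ≥0} (hf : ApproximatesLinearOn f A S (ε * ‖A‖₊))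
    (hc : c * (1 + ε) ≤ 4 - 2 * Real.pi * ε) :
    c * μH[1] (f '' S) ≤ kinematicMeasure (linesMeeting (f '' S)) := by
  have hsection : ∀ φ, ApproximatesLinearOn (normalCoord φ ∘ f) (normalCoord φ ∘L A) S
      (ε * ‖A‖₊) := fun φ x hx y hy => by
    have hproj := (abs_normalCoord_le φ _).trans (hf x hx y hy)
    rwa [map_sub, map_sub] at hproj
  calc c * μH[1] (f '' S) ≤ c * ((‖A‖₊ + ε * ‖A‖₊ : ℝ≥0) * volume S) := by
        gcongr; exact hausdorffMeasure_image_le_of_approximatesLinearOn hf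
    _ = ENNReal.ofReal (c * (1 + ε) * ‖A‖) * volume S := by
        rw [← mul_assoc, ← ENNReal.coe_mul, ← ENNReal.ofReal_coe_nnreal]
        congr 2
        push_cast
        ring
    _ ≤ ENNReal.ofReal (4 * ‖A‖ - 2 * Real.pi * (ε * ‖A‖₊ : ℝ≥0)) * volume S := by
        gcongr
        have := mul_le_mul_of_nonneg_right hc (norm_nonneg A)
        push_cast
        linarith
    _ ≤ (∫⁻ φ in Ico 0 (2 * Real.pi), ENNReal.ofReal (‖normalCoord φ ∘L A‖ - (ε * ‖A‖₊ : ℝ≥0))) *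
          volume S := by
        gcongr; exact ofReal_sub_le_lintegral_norm_normalCoord_comp A _
    _ ≤ ∫⁻ φ in Ico 0 (2 * Real.pi),
          ENNReal.ofReal (‖normalCoord φ ∘L A‖ - (ε * ‖A‖₊ : ℝ≥0)) * volume S :=
        lintegral_mul_const_le _ _
    _ ≤ ∫⁻ φ in Ico 0 (2 * Real.pi), volume (Prod.mk φ ⁻¹' linesMeeting (f '' S)) :=
        lintegral_mono fun φ => by
          rw [section_linesMeeting, ← image_comp, ← hausdorffMeasure_real]
          simpa only [hausdorffMeasure_real] using
            ofReal_mul_volume_le_of_approximatesLinearOn (hsection φ)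
    _ ≤ kinematicMeasure (linesMeeting (f '' S)) := lintegral_section_le_kinematicMeasure _

/-! ### Half of Crofton's formula -/

/-- A Borel set all of whose subsets `A` satisfy Crofton's inequality up to the constant `c`
(instead of `4`). Almost linear pieces of curves are such sets. -/
def IsCroftonPiece (c : ℝ≥0) (B : Set Plane) : Prop :=
  MeasurableSet B ∧ ∀ A ⊆ B, c * μH[1] A ≤ kinematicMeasure (linesMeeting A)

lemma exists_isCroftonPiece_cover_of_deriv_ne_zero {f : ℝ → Plane} {s : Set ℝ}
    (hs : MeasurableSet s) (hf : Continuous f) (hdiff : ∀ x ∈ s, DifferentiableAt ℝ f x)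
    (hderiv : ∀ x ∈ s, deriv f x ≠ 0) {c : ℝ≥0} (hc : c < 4) :
    ∃ B : ℕ → Set Plane, (∀ k, IsCroftonPiece c (B k)) ∧ f '' s ⊆ ⋃ k, B k := by
  classical
  obtain ⟨ε, hε0, hε1, hεc⟩ : ∃ ε : ℝ≥0, 0 < ε ∧ ε < 1 ∧
      (c * (1 + ε) : ℝ) ≤ 4 - 2 * Real.pi * ε := by
    have hc' : (c : ℝ) < 4 := by exact_mod_cast hc
    have hden : 0 < c + 2 * Real.pi := by positivity
    refine ⟨⟨(4 - c) / (c + 2 * Real.pi), div_nonneg (sub_nonneg.2 hc'.le) hden.le⟩,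
      div_pos (sub_pos.2 hc') hden, (div_lt_one hden).2 ?_, le_of_eq ?_⟩
    · linarith [Real.pi_gt_three, c.coe_nonneg]
    · change (c : ℝ) * (1 + (4 - c) / (c + 2 * Real.pi)) =
        4 - 2 * Real.pi * ((4 - c) / (c + 2 * Real.pi))
      field_simp
      ring
  obtain ⟨t, A, -, ht, hst, happ, hA⟩ :=
    exists_partition_approximatesLinearOn_of_hasFDerivWithinAt f s (fun x => fderiv ℝ f x)
      (fun x hx => (hdiff x hx).hasFDerivAt.hasFDerivWithinAt)
      (fun A => if A = 0 then 1 else ε * ‖A‖₊) (fun A => by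
        split_ifs with h
        · exact one_ne_zero
        · exact mul_ne_zero hε0.ne' (nnnorm_ne_zero_iff.2 h))
  refine ⟨fun k => f '' (s ∩ t k), fun k => ?_, ?_⟩
  · rcases s.eq_empty_or_nonempty with rfl | hne
    · simp [IsCroftonPiece]
    have hA0 : A k ≠ 0 := by
      obtain ⟨z, hz, hAz⟩ := hA hne k
      exact fun h => hderiv z hz (by rw [← fderiv_apply_one_eq_deriv, ← hAz, h]; rfl)
    have happk := happ k
    rw [if_neg hA0] at happk
    refine ⟨(hs.inter (ht k)).image_of_continuousOn_injOn hf.continuousOn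
      (injOn_of_approximatesLinearOn happk ?_), fun B hB => ?_⟩
    · simpa using mul_lt_of_lt_one_left (norm_pos_iff.2 hA0) (by exact_mod_cast hε1)
    · obtain ⟨T, hT, rfl⟩ := subset_image_iff.1 hB
      exact mul_hausdorffMeasure_le_kinematicMeasure_of_approximatesLinearOn
        (happk.mono_set hT) hεc
  · rw [← image_iUnion, ← inter_iUnion, inter_eq_left.2 hst]

lemma exists_isCroftonPiece_cover_range {f : ℝ → Plane} {K : ℝ≥0} (hf : LipschitzWith K f)
    {c : ℝ≥0} (hc : c < 4) :
    ∃ B : ℕ → Set Plane, (∀ k, IsCroftonPiece c (B k)) ∧ μH[1] (range f \ ⋃ k, B k) = 0 := by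
  set D : Set ℝ := {x | DifferentiableAt ℝ f x}
  set C : Set ℝ := {x | deriv f x = 0}
  have hD : MeasurableSet D := measurableSet_of_differentiableAt ℝ f
  have hC : MeasurableSet C := measurable_deriv f (measurableSet_singleton 0)
  obtain ⟨B, hB, hcover⟩ := exists_isCroftonPiece_cover_of_deriv_ne_zero (hD.diff hC)
    hf.continuous (fun x hx => hx.1) (fun x hx => hx.2) hc
  refine ⟨B, hB, ?_⟩
  have hnondiff : μH[1] (f '' Dᶜ) = 0 := by
    have hle := hf.hausdorffMeasure_image_le zero_le_one Dᶜ
    rw [hausdorffMeasure_real, show volume Dᶜ = 0 from hf.ae_differentiableAt_real, mul_zero] at hle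
    exact le_antisymm hle zero_le
  have hcrit : μH[1] (f '' (D ∩ C)) = 0 :=
    hausdorffMeasure_image_eq_zero_of_hasDerivWithinAt_zero fun x hx =>
      (hx.2 ▸ hx.1.hasDerivAt :).hasDerivWithinAt
  refine measure_mono_null ?_ (measure_union_null hnondiff hcrit)
  rw [sdiff_subset_iff, ← image_univ]
  refine Subset.trans ?_ (union_subset_union_left _ hcover)
  rw [← image_union, ← image_union]
  exact image_mono fun x _ => by by_cases x ∈ D <;> by_cases x ∈ C <;> simp [*]

lemma IsOneRectifiable.exists_disjoint_isCroftonPiece {S : Set Plane} (hS : IsOneRectifiable S)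
    {c : ℝ≥0} (hc : c < 4) :
    ∃ B : ℕ → Set Plane, Pairwise (Function.onFun Disjoint B) ∧ (∀ k, IsCroftonPiece c (B k)) ∧
      μH[1] (S \ ⋃ k, B k) = 0 := by
  obtain ⟨-, f, hf, hnull⟩ := hS
  choose K hK using hf
  choose B hB hB0 using fun i => exists_isCroftonPiece_cover_range (hK i) hc
  let B' : ℕ → Set Plane := fun n => B n.unpair.1 n.unpair.2
  have hB' : ∀ n, IsCroftonPiece c (B' n) := fun n => hB _ _
  have hiUnion : ⋃ n, B' n = ⋃ i, ⋃ k, B i k := iUnion_unpair B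
  refine ⟨disjointed B', disjoint_disjointed B', fun n =>
    ⟨MeasurableSet.disjointed (fun n => (hB' n).1) n, fun A hA =>
      (hB' n).2 A (hA.trans (disjointed_subset B' n))⟩, ?_⟩
  rw [iUnion_disjointed, hiUnion]
  refine measure_mono_null ?_ (measure_union_null hnull (measure_iUnion_null hB0))
  intro x ⟨hxS, hx⟩
  by_cases hxf : x ∈ ⋃ i, range (f i)
  · obtain ⟨i, hi⟩ := mem_iUnion.1 hxf
    exact Or.inr (mem_iUnion.2 ⟨i, hi, fun h => hx (mem_iUnion.2 ⟨i, h⟩)⟩)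
  · exact Or.inl ⟨hxS, hxf⟩

lemma IsOneRectifiable.mono {S T : Set Plane} (hS : IsOneRectifiable S) (hTS : T ⊆ S)
    (hT : NullMeasurableSet T (μH[1])) : IsOneRectifiable T := by
  obtain ⟨-, f, hf, h0⟩ := hS
  exact ⟨hT, f, hf, measure_mono_null (sdiff_subset_sdiff_left hTS) h0⟩

/-- The set `A`, each point counted once, as a multiplicity function. -/
noncomputable def multiplicityOne (A : Set Plane) : Plane → ℕ := A.indicator 1

lemma natCast_multiplicityOne (A : Set Plane) (x : Plane) :
    (multiplicityOne A x : ℝ≥0∞) = A.indicator 1 x := by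
  by_cases h : x ∈ A <;> simp [multiplicityOne, h]

lemma indicator_linesMeeting_le_intersectionNumber (A : Set Plane) (q : ℝ × ℝ) :
    (linesMeeting A).indicator 1 q ≤ intersectionNumber (multiplicityOne A) q := by
  refine indicator_le (fun q hq => ?_) q
  obtain ⟨x, hxA, hxq⟩ := hq
  calc (1 : ℝ≥0∞) = multiplicityOne A x := by simp [natCast_multiplicityOne, hxA]
    _ ≤ intersectionNumber (multiplicityOne A) q :=
        ENNReal.le_tsum (f := fun y : lineOf q => (multiplicityOne A y : ℝ≥0∞))
          ⟨x, mem_lineOf.2 hxq⟩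

lemma tsum_indicator_le_of_disjoint {ι X : Type*} {A : Set X} {B : ι → Set X}
    (hB : Pairwise (Function.onFun Disjoint B)) (hBA : ∀ k, B k ⊆ A) (x : X) :
    ∑' k, (B k).indicator (1 : X → ℝ≥0∞) x ≤ A.indicator 1 x := by
  by_cases h : ∃ k, x ∈ B k
  · obtain ⟨k, hk⟩ := h
    rw [tsum_eq_single k fun j hj => indicator_of_notMem
      (fun hxj => disjoint_left.1 (hB hj) hxj hk) _]
    exact indicator_le_indicator_of_subset (hBA k) (fun _ => zero_le) x
  · simp only [not_exists] at h
    simp [indicator_of_notMem (h _)]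

lemma tsum_lintegral_le_lintegral_tsum {α : Type*} [MeasurableSpace α] (μ : Measure α)
    (f : ℕ → α → ℝ≥0∞) : ∑' n, ∫⁻ a, f n a ∂μ ≤ ∫⁻ a, ∑' n, f n a ∂μ := by
  choose g hg hgf hint using fun n => exists_measurable_le_lintegral_eq μ (f n)
  simp only [hint]
  rw [← lintegral_tsum fun n => (hg n).aemeasurable]
  exact lintegral_mono fun a => ENNReal.tsum_le_tsum fun n => hgf n a

lemma tsum_lintegral_intersectionNumber_le {η : ℕ → Plane → ℕ} {θ : Plane → ℕ}
    (h : ∀ x, ∑' k, (η k x : ℝ≥0∞) ≤ θ x) :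
    ∑' k, ∫⁻ q, intersectionNumber (η k) q ∂kinematicMeasure ≤
      ∫⁻ q, intersectionNumber θ q ∂kinematicMeasure := by
  refine (tsum_lintegral_le_lintegral_tsum _ _).trans (lintegral_mono fun q => ?_)
  exact ENNReal.tsum_comm.trans_le (ENNReal.tsum_le_tsum fun x => h x)

lemma IsOneRectifiable.four_mul_hausdorffMeasure_le_lintegral {A : Set Plane}
    (hA : IsOneRectifiable A) (hfin : μH[1] A ≠ ⊤) :
    4 * μH[1] A ≤ ∫⁻ q, intersectionNumber (multiplicityOne A) q ∂kinematicMeasure := by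
  refine ENNReal.mul_le_of_forall_lt fun c hc b hb => ?_
  lift c to ℝ≥0 using hc.ne_top
  obtain ⟨B, hdisj, hB, hnull⟩ := hA.exists_disjoint_isCroftonPiece (by exact_mod_cast hc)
  have hlines : ∀ k, NullMeasurableSet (linesMeeting (A ∩ B k)) kinematicMeasure := fun k =>
    nullMeasurableSet_linesMeeting (hA.1.inter (hB k).1.nullMeasurableSet)
      (measure_ne_top_of_subset inter_subset_left hfin)
  have hlength : μH[1] A ≤ ∑' k, μH[1] (A ∩ B k) :=
    calc μH[1] A ≤ μH[1] (A ∩ ⋃ k, B k) + μH[1] (A \ ⋃ k, B k) := measure_le_inter_add_sdiff _ _ _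
      _ ≤ ∑' k, μH[1] (A ∩ B k) := by
          rw [hnull, add_zero, inter_iUnion]
          exact measure_iUnion_le _
  have hmult : ∀ x, ∑' k, (multiplicityOne (A ∩ B k) x : ℝ≥0∞) ≤ multiplicityOne A x := fun x => by
    simp only [natCast_multiplicityOne]
    exact tsum_indicator_le_of_disjoint
      (fun i j hij => (hdisj hij).mono inter_subset_right inter_subset_right)
      (fun k => inter_subset_left) x
  calc (c : ℝ≥0∞) * b ≤ c * ∑' k, μH[1] (A ∩ B k) := by gcongr; exact hb.le.trans hlength
    _ = ∑' k, c * μH[1] (A ∩ B k) := ENNReal.tsum_mul_left.symm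
    _ ≤ ∑' k, kinematicMeasure (linesMeeting (A ∩ B k)) :=
        ENNReal.tsum_le_tsum fun k => (hB k).2 _ inter_subset_right
    _ = ∑' k, ∫⁻ q, (linesMeeting (A ∩ B k)).indicator 1 q ∂kinematicMeasure :=
        tsum_congr fun k => (lintegral_indicator_one₀ (hlines k)).symm
    _ ≤ ∑' k, ∫⁻ q, intersectionNumber (multiplicityOne (A ∩ B k)) q ∂kinematicMeasure :=
        ENNReal.tsum_le_tsum fun k =>
          lintegral_mono (indicator_linesMeeting_le_intersectionNumber _)
    _ ≤ ∫⁻ q, intersectionNumber (multiplicityOne A) q ∂kinematicMeasure :=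
        tsum_lintegral_intersectionNumber_le hmult

/-- The points of multiplicity greater than `k`. -/
def layer (θ : Plane → ℕ) (k : ℕ) : Set Plane := {x | k < θ x}

lemma natCast_eq_tsum_indicator_layer (θ : Plane → ℕ) (x : Plane) :
    (θ x : ℝ≥0∞) = ∑' k, (layer θ k).indicator 1 x := by
  rw [tsum_eq_sum (s := Finset.range (θ x)) fun k hk => by simpa [layer] using hk,
    Finset.sum_congr rfl fun k hk =>
      indicator_of_mem (show x ∈ layer θ k from Finset.mem_range.1 hk) _]
  simp

lemma multisetLength_eq_tsum_layer {θ : Plane → ℕ} (hθ : NullMeasurable θ (μH[1] : Measure Plane)) :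
    multisetLength θ = ∑' k, μH[1] (layer θ k) := by
  have hlayer : ∀ k, NullMeasurableSet (layer θ k) (μH[1] : Measure Plane) := fun k =>
    hθ (measurableSet_Ioi (a := k))
  simp_rw [multisetLength, natCast_eq_tsum_indicator_layer θ]
  rw [lintegral_tsum fun k => (measurable_one.aemeasurable).indicator₀ (hlayer k)]
  exact tsum_congr fun k => lintegral_indicator_one₀ (hlayer k)

lemma IsOneRectifiableMultiset.four_mul_multisetLength_le_lintegral {θ : Plane → ℕ}
    (hθ : IsOneRectifiableMultiset θ) (hfin : multisetLength θ ≠ ⊤) :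
    4 * multisetLength θ ≤ ∫⁻ q, intersectionNumber θ q ∂kinematicMeasure := by
  rw [multisetLength_eq_tsum_layer hθ.1] at hfin ⊢
  calc 4 * ∑' k, μH[1] (layer θ k) = ∑' k, 4 * μH[1] (layer θ k) := ENNReal.tsum_mul_left.symm
    _ ≤ ∑' k, ∫⁻ q, intersectionNumber (multiplicityOne (layer θ k)) q ∂kinematicMeasure := by
        refine ENNReal.tsum_le_tsum fun k => ?_
        refine IsOneRectifiable.four_mul_hausdorffMeasure_le_lintegral
          (hθ.2.mono (fun x hx => (Nat.zero_le k |>.trans_lt hx).ne')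
            (hθ.1 (measurableSet_Ioi (a := k)))) (ENNReal.ne_top_of_tsum_ne_top hfin k)
    _ ≤ ∫⁻ q, intersectionNumber θ q ∂kinematicMeasure :=
        tsum_lintegral_intersectionNumber_le fun x => by
          simp only [natCast_multiplicityOne]
          exact (natCast_eq_tsum_indicator_layer θ x).ge

/-! ### The boundary of a convex domain -/

section ConvexDomain

variable {E : Type*} [NormedAddCommGroup E] [NormedSpace ℝ E]

/-- A bounded convex domain: a bounded convex open set, possibly empty. -/
structure IsConvexDomain (Ω : Set E) : Prop where
  isOpen : IsOpen Ω
  isBounded : Bornology.IsBounded Ω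
  convex : Convex ℝ Ω

/-- The Minkowski gauge of `Ω` with respect to the centre `c`. -/
noncomputable def gaugeAt (Ω : Set E) (c v : E) : ℝ := gauge ((c + ·) ⁻¹' Ω) v

/-- The boundary point of `Ω` seen from `c` in the direction `v`. -/
noncomputable def radialPoint (Ω : Set E) (c v : E) : E := c + (gaugeAt Ω c v)⁻¹ • v

lemma gaugeAt_smul {Ω : Set E} {c : E} {a : ℝ} (ha : 0 ≤ a) (v : E) :
    gaugeAt Ω c (a • v) = a * gaugeAt Ω c v :=
  gauge_smul_of_nonneg ha v

namespace IsConvexDomain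

variable {Ω : Set E} {c : E}

lemma convex_translate (h : IsConvexDomain Ω) (c : E) : Convex ℝ ((c + ·) ⁻¹' Ω) :=
  h.convex.translate_preimage_right c

lemma isCompact_frontier [ProperSpace E] (h : IsConvexDomain Ω) : IsCompact (frontier Ω) :=
  h.isBounded.isCompact_closure.of_isClosed_subset isClosed_frontier frontier_subset_closure

lemma translate_mem_nhds (h : IsConvexDomain Ω) (hc : c ∈ Ω) : (c + ·) ⁻¹' Ω ∈ 𝓝 (0 : E) :=
  (h.isOpen.preimage (continuous_const_add c)).mem_nhds (by simpa using hc)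

lemma isBounded_translate (h : IsConvexDomain Ω) (c : E) :
    Bornology.IsBounded ((c + ·) ⁻¹' Ω) :=
  (isometry_add_left c).antilipschitz.isBounded_preimage h.isBounded

lemma gaugeAt_pos (h : IsConvexDomain Ω) (hc : c ∈ Ω) {v : E} (hv : v ≠ 0) :
    0 < gaugeAt Ω c v :=
  (gauge_pos (absorbent_nhds_zero (h.translate_mem_nhds hc))
    ((NormedSpace.isVonNBounded_iff ℝ).2 (h.isBounded_translate c))).2 hv

lemma gaugeAt_eq_one_iff (h : IsConvexDomain Ω) (hc : c ∈ Ω) (v : E) :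
    gaugeAt Ω c v = 1 ↔ c + v ∈ frontier Ω := by
  rw [gaugeAt, gauge_eq_one_iff_mem_frontier (h.convex_translate c) (h.translate_mem_nhds hc),
    ← (isOpenMap_add_left c).preimage_frontier_eq_frontier_preimage (continuous_const_add c),
    mem_preimage]

lemma add_smul_mem_frontier_iff (h : IsConvexDomain Ω) (hc : c ∈ Ω) {v : E} (hv : v ≠ 0) {a : ℝ}
    (ha : 0 ≤ a) : c + a • v ∈ frontier Ω ↔ a = (gaugeAt Ω c v)⁻¹ := by
  rw [← h.gaugeAt_eq_one_iff hc, gaugeAt_smul ha, mul_eq_one_iff_eq_inv₀ (h.gaugeAt_pos hc hv).ne']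

lemma radialPoint_mem_frontier (h : IsConvexDomain Ω) (hc : c ∈ Ω) {v : E} (hv : v ≠ 0) :
    radialPoint Ω c v ∈ frontier Ω :=
  (h.add_smul_mem_frontier_iff hc hv (inv_nonneg.2 (h.gaugeAt_pos hc hv).le)).2 rfl

lemma radialPoint_ne_radialPoint_neg (h : IsConvexDomain Ω) (hc : c ∈ Ω) {v : E} (hv : v ≠ 0) :
    radialPoint Ω c v ≠ radialPoint Ω c (-v) := by
  have hpos := inv_pos.2 (h.gaugeAt_pos hc hv)
  have hneg := inv_pos.2 (h.gaugeAt_pos hc (neg_ne_zero.2 hv))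
  rw [radialPoint, radialPoint, Ne, add_right_inj, smul_neg, ← add_eq_zero_iff_eq_neg, ← add_smul,
    smul_eq_zero]
  exact not_or.2 ⟨(add_pos hpos hneg).ne', hv⟩

lemma range_line_inter_frontier (h : IsConvexDomain Ω) (hc : c ∈ Ω) {v : E} (hv : v ≠ 0) :
    (range fun a : ℝ => c + a • v) ∩ frontier Ω = {radialPoint Ω c v, radialPoint Ω c (-v)} := by
  refine Subset.antisymm ?_ ?_
  · rintro _ ⟨⟨a, rfl⟩, ha⟩
    rcases le_total 0 a with h0 | h0
    · exact Or.inl (by rw [radialPoint, ← (h.add_smul_mem_frontier_iff hc hv h0).1 ha])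
    · beta_reduce at ha
      rw [← neg_smul_neg, h.add_smul_mem_frontier_iff hc (neg_ne_zero.2 hv) (neg_nonneg.2 h0)] at ha
      exact Or.inr (by rw [mem_singleton_iff, radialPoint, ← ha, neg_smul_neg])
  · refine insert_subset ⟨⟨_, rfl⟩, h.radialPoint_mem_frontier hc hv⟩
      (singleton_subset_iff.2 ⟨⟨-(gaugeAt Ω c (-v))⁻¹, ?_⟩,
        h.radialPoint_mem_frontier hc (neg_ne_zero.2 hv)⟩)
    simp [radialPoint]

end IsConvexDomain

lemma lipschitzWith_inv_smul {X : Type*} [PseudoMetricSpace X] {g : X → ℝ} {u : X → E}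
    {K L R : ℝ≥0} (hg : LipschitzWith K g) (hu : LipschitzWith L u) (hu1 : ∀ x, ‖u x‖ = 1)
    (hR : 0 < R) (hgR : ∀ x, (R : ℝ)⁻¹ ≤ g x) :
    LipschitzWith (R * R * K + R * L) fun x => (g x)⁻¹ • u x := by
  have hg0 : ∀ x, 0 < g x := fun x => (inv_pos.2 (NNReal.coe_pos.2 hR)).trans_le (hgR x)
  have hinv : ∀ x, (g x)⁻¹ ≤ R := fun x => inv_le_of_inv_le₀ (NNReal.coe_pos.2 hR) (hgR x)
  have hinv0 : ∀ x, 0 ≤ (g x)⁻¹ := fun x => inv_nonneg.2 (hg0 x).le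
  refine LipschitzWith.of_dist_le_mul fun x y => ?_
  have hradius : |(g x)⁻¹ - (g y)⁻¹| ≤ R * R * (K * dist x y) := by
    rw [inv_sub_inv (hg0 x).ne' (hg0 y).ne', div_eq_inv_mul, mul_inv, abs_mul, abs_mul,
      abs_of_nonneg (hinv0 x), abs_of_nonneg (hinv0 y), ← Real.dist_eq, dist_comm]
    exact mul_le_mul (mul_le_mul (hinv x) (hinv y) (hinv0 y) R.2) (hg.dist_le_mul x y)
      dist_nonneg (by positivity)
  have hangle : (g y)⁻¹ * ‖u x - u y‖ ≤ R * (L * dist x y) :=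
    mul_le_mul (hinv y) (by simpa [dist_eq_norm] using hu.dist_le_mul x y) (norm_nonneg _) R.2
  calc dist ((g x)⁻¹ • u x) ((g y)⁻¹ • u y)
      = ‖((g x)⁻¹ - (g y)⁻¹) • u x + (g y)⁻¹ • (u x - u y)‖ := by
        rw [dist_eq_norm]; congr 1; module
    _ ≤ |(g x)⁻¹ - (g y)⁻¹| + (g y)⁻¹ * ‖u x - u y‖ := by
        refine (norm_add_le _ _).trans_eq ?_
        rw [norm_smul, norm_smul, hu1, mul_one, Real.norm_eq_abs, Real.norm_of_nonneg (hinv0 y)]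
    _ ≤ (R * R * K + R * L : ℝ≥0) * dist x y := by
        push_cast
        linarith

end ConvexDomain

lemma unitVec_periodic : Function.Periodic unitVec (2 * Real.pi) := fun t => by
  simp [unitVec]

lemma lipschitzWith_unitVec : LipschitzWith 1 unitVec := by
  refine LipschitzWith.of_dist_le_mul fun s t => ?_
  rw [NNReal.coe_one, one_mul, dist_eq_norm, Real.dist_eq]
  refine le_of_sq_le_sq ?_ (abs_nonneg _)
  have hcos := Real.one_sub_sq_div_two_le_cos (x := s - t)
  rw [Real.cos_sub] at hcos
  rw [Plane.norm_sq, sq_abs]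
  simp only [PiLp.sub_apply, unitVec_zero_apply, unitVec_one_apply]
  nlinarith [Real.sin_sq_add_cos_sq s, Real.sin_sq_add_cos_sq t]

lemma injOn_unitVec : InjOn unitVec (Ico 0 (2 * Real.pi)) := fun s hs t ht h => by
  have hcos : Real.cos s = Real.cos t := congrArg (fun v : Plane => v 0) h
  have hsin : Real.sin s = Real.sin t := congrArg (fun v : Plane => v 1) h
  have hsub : Real.cos (s - t) = 1 := by
    rw [Real.cos_sub, hcos, hsin, ← sq, ← sq, Real.cos_sq_add_sin_sq]
  exact sub_eq_zero.1 ((Real.cos_eq_one_iff_of_lt_of_lt (by linarith [hs.1, ht.2])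
    (by linarith [hs.2, ht.1])).1 hsub)

lemma lineOf_eq_range {q : ℝ × ℝ} {x : Plane} (hx : normalCoord q.1 x = q.2) :
    lineOf q = range fun a : ℝ => x + a • unitVec (q.1 + Real.pi / 2) := by
  have hcs := Real.sin_sq_add_cos_sq q.1
  ext y
  rw [mem_lineOf, ← hx, mem_range]
  simp only [normalCoord_apply]
  constructor
  · intro hy
    refine ⟨(y 1 - x 1) * Real.cos q.1 - (y 0 - x 0) * Real.sin q.1, ?_⟩
    ext i
    fin_cases i
    · simp [Real.cos_add_pi_div_two]
      linear_combination (y 0 - x 0) * hcs - Real.cos q.1 * hy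
    · simp [Real.sin_add_pi_div_two]
      linear_combination (y 1 - x 1) * hcs - Real.sin q.1 * hy
  · rintro ⟨a, rfl⟩
    simp [Real.cos_add_pi_div_two, Real.sin_add_pi_div_two]
    ring

namespace IsConvexDomain

variable {Ω : Set Plane}

lemma exists_lineOf_inter_frontier_eq (h : IsConvexDomain Ω) {q : ℝ × ℝ}
    (hq : q ∈ linesMeeting Ω) : ∃ y z, y ≠ z ∧ lineOf q ∩ frontier Ω = {y, z} := by
  obtain ⟨x, hx, hxq⟩ := hq
  have hv := unitVec_ne_zero (q.1 + Real.pi / 2)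
  exact ⟨_, _, h.radialPoint_ne_radialPoint_neg hx hv, by
    rw [lineOf_eq_range hxq, h.range_line_inter_frontier hx hv]⟩

lemma measurableSet_linesMeeting (h : IsConvexDomain Ω) : MeasurableSet (linesMeeting Ω) := by
  have := h.isOpen.locallyCompactSpace
  exact _root_.measurableSet_linesMeeting (isSigmaCompact_iff_sigmaCompactSpace.2 inferInstance)

lemma ae_mem_linesMeeting (h : IsConvexDomain Ω) :
    ∀ᵐ q ∂kinematicMeasure, q ∈ linesMeeting (closure Ω) → q ∈ linesMeeting Ω := by
  have hm : MeasurableSet (linesMeeting (closure Ω) \ linesMeeting Ω) :=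
    (isClosed_linesMeeting h.isBounded.isCompact_closure).measurableSet.diff
      h.measurableSet_linesMeeting
  suffices h0 : kinematicMeasure (linesMeeting (closure Ω) \ linesMeeting Ω) = 0 from
    measure_mono_null (fun q hq => Classical.not_imp.1 hq) h0
  rw [kinematicMeasure_apply hm]
  refine (lintegral_congr fun φ => ?_).trans lintegral_zero
  have hinterval : Convex ℝ (normalCoord φ '' Ω) :=
    h.convex.linear_image (normalCoord φ).toLinearMap
  refine measure_mono_null ?_ (hinterval.addHaar_frontier volume)
  rw [preimage_sdiff, section_linesMeeting, section_linesMeeting]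
  exact sdiff_subset_sdiff (image_closure_subset_closure_image (normalCoord φ).continuous)
    interior_subset

end IsConvexDomain

/-- The parametrization of the boundary of `Ω` by the angle at `c`. -/
noncomputable def boundaryCurve (Ω : Set Plane) (c : Plane) (t : ℝ) : Plane :=
  radialPoint Ω c (unitVec t)

lemma boundaryCurve_two_pi (Ω : Set Plane) (c : Plane) :
    boundaryCurve Ω c (2 * Real.pi) = boundaryCurve Ω c 0 := by
  rw [boundaryCurve, boundaryCurve, unitVec_periodic.eq]

namespace IsConvexDomain

variable {Ω : Set Plane} {c : Plane}

lemma boundaryCurve_mem_frontier (h : IsConvexDomain Ω) (hc : c ∈ Ω) (t : ℝ) :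
    boundaryCurve Ω c t ∈ frontier Ω := h.radialPoint_mem_frontier hc (unitVec_ne_zero t)

lemma image_boundaryCurve (h : IsConvexDomain Ω) (hc : c ∈ Ω) :
    boundaryCurve Ω c '' Ico 0 (2 * Real.pi) = frontier Ω := by
  refine Subset.antisymm (image_subset_iff.2 fun t _ => h.boundaryCurve_mem_frontier hc t) ?_
  intro y hy
  obtain ⟨t, ht⟩ := exists_eq_norm_smul_unitVec (y - c)
  obtain ⟨s, hs, hst⟩ := (unitVec_periodic).exists_mem_Ico₀ Real.two_pi_pos t
  refine ⟨s, hs, ?_⟩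
  have hy' : c + ‖y - c‖ • unitVec t ∈ frontier Ω := by rwa [← ht, add_sub_cancel]
  rw [h.add_smul_mem_frontier_iff hc (unitVec_ne_zero t) (norm_nonneg _)] at hy'
  rw [boundaryCurve, ← hst, radialPoint, ← hy', ← ht, add_sub_cancel]

lemma injOn_boundaryCurve (h : IsConvexDomain Ω) (hc : c ∈ Ω) :
    InjOn (boundaryCurve Ω c) (Ico 0 (2 * Real.pi)) := by
  intro s hs t ht hst
  have hpos : ∀ t, 0 < (gaugeAt Ω c (unitVec t))⁻¹ := fun t =>
    inv_pos.2 (h.gaugeAt_pos hc (unitVec_ne_zero t))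
  have hsmul : (gaugeAt Ω c (unitVec s))⁻¹ • unitVec s = (gaugeAt Ω c (unitVec t))⁻¹ • unitVec t :=
    add_left_cancel hst
  have hnorm := congrArg norm hsmul
  simp only [norm_smul, norm_unitVec, mul_one, Real.norm_of_nonneg (hpos _).le] at hnorm
  rw [hnorm] at hsmul
  exact injOn_unitVec hs ht (smul_right_injective Plane (hpos t).ne' hsmul)

lemma exists_lipschitzWith_boundaryCurve (h : IsConvexDomain Ω) (hc : c ∈ Ω) :
    ∃ K, LipschitzWith K (boundaryCurve Ω c) := by
  obtain ⟨K, hK⟩ := (h.convex_translate c).lipschitz_gauge (h.translate_mem_nhds hc)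
  obtain ⟨R, hR0, hR⟩ := (h.isBounded_translate c).subset_ball_lt 0 0
  lift R to ℝ≥0 using hR0.le
  have hgauge : ∀ t, (R : ℝ)⁻¹ ≤ gaugeAt Ω c (unitVec t) := fun t => by
    simpa [gaugeAt, norm_unitVec] using le_gauge_of_subset_closedBall
      (absorbent_nhds_zero (h.translate_mem_nhds hc)) hR0.le
      (hR.trans Metric.ball_subset_closedBall) (x := unitVec t)
  have hlip := lipschitzWith_inv_smul (hK.comp lipschitzWith_unitVec) lipschitzWith_unitVec
    norm_unitVec (NNReal.coe_pos.1 hR0) hgauge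
  exact ⟨_, ((isometry_add_left c).lipschitz.comp hlip)⟩

end IsConvexDomain

/-! ### Parametrization by arc length -/

section ArcLength

variable {X : Type*} [MetricSpace X]

/-- A closed curve with parameter interval `[0, T]`, Lipschitz and injective on `[0, T)`. -/
structure IsSimpleClosedCurve (γ : ℝ → X) (T : ℝ) : Prop where
  nonneg : 0 ≤ T
  exists_lipschitzWith : ∃ K, LipschitzWith K γ
  injOn : InjOn γ (Ico 0 T)
  closed : γ T = γ 0

lemma IsSimpleClosedCurve.continuous {γ : ℝ → X} {T : ℝ} (h : IsSimpleClosedCurve γ T) :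
    Continuous γ :=
  h.exists_lipschitzWith.choose_spec.continuous

variable [MeasurableSpace X] [BorelSpace X]

lemma edist_le_hausdorffMeasure_image_Ico {γ : ℝ → X} {a b : ℝ} (hab : a ≤ b)
    (hγ : ContinuousOn γ (Icc a b)) : edist (γ a) (γ b) ≤ μH[1] (γ '' Ico a b) := by
  have hlip : LipschitzWith 1 (dist (γ a)) := LipschitzWith.dist_right (γ a)
  have hivt := intermediate_value_Ico hab (hlip.continuous.comp_continuousOn hγ)
  calc edist (γ a) (γ b) = μH[1] (Ico (dist (γ a) (γ a)) (dist (γ a) (γ b))) := by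
        rw [hausdorffMeasure_real, Real.volume_Ico, dist_self, sub_zero, edist_dist]
    _ ≤ μH[1] (dist (γ a) '' (γ '' Ico a b)) := measure_mono (by rwa [← image_comp])
    _ ≤ μH[1] (γ '' Ico a b) := by
        simpa using hlip.hausdorffMeasure_image_le zero_le_one (γ '' Ico a b)

/-- The length of `γ` on `[0, t)`. It is a sensible notion only where `γ` is injective, since
points are counted once. -/
noncomputable def arcLength (γ : ℝ → X) (t : ℝ) : ℝ := (μH[1] (γ '' Ico 0 t)).toReal

lemma arcLength_nonneg (γ : ℝ → X) (t : ℝ) : 0 ≤ arcLength γ t := ENNReal.toReal_nonneg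

/-- A parametrization of the closed curve `Γ` by arc length: `σ` goes around `Γ` once on `[0, P]`.
-/
structure IsArcLengthParametrization (Γ : Set X) (P : ℝ) (σ : ℝ → X) : Prop where
  image_Ico : σ '' Ico 0 P = Γ
  injOn : InjOn σ (Ico 0 P)
  closed : σ P = σ 0
  lipschitzOnWith : LipschitzOnWith 1 σ (Icc 0 P)
  hausdorffMeasure_image_Ico :
    ∀ ⦃a b⦄, 0 ≤ a → a ≤ b → b ≤ P → μH[1] (σ '' Ico a b) = ENNReal.ofReal (b - a)

namespace IsSimpleClosedCurve

variable {γ : ℝ → X} {T a b : ℝ}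

lemma measurableSet_image_Ico (h : IsSimpleClosedCurve γ T) (ha : 0 ≤ a) (hb : b ≤ T) :
    MeasurableSet (γ '' Ico a b) :=
  measurableSet_Ico.image_of_continuousOn_injOn h.continuous.continuousOn
    (h.injOn.mono (Ico_subset_Ico ha hb))

lemma exists_hausdorffMeasure_image_Ico_le (h : IsSimpleClosedCurve γ T) :
    ∃ K : ℝ≥0, ∀ a b, μH[1] (γ '' Ico a b) ≤ K * ENNReal.ofReal (b - a) := by
  obtain ⟨K, hK⟩ := h.exists_lipschitzWith
  refine ⟨K, fun a b => (hK.hausdorffMeasure_image_le zero_le_one _).trans_eq ?_⟩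
  rw [hausdorffMeasure_real, Real.volume_Ico, ENNReal.rpow_one]

lemma hausdorffMeasure_image_Ico_ne_top (h : IsSimpleClosedCurve γ T) (a b : ℝ) :
    μH[1] (γ '' Ico a b) ≠ ⊤ := by
  obtain ⟨K, hK⟩ := h.exists_hausdorffMeasure_image_Ico_le
  exact ((hK a b).trans_lt (ENNReal.mul_lt_top ENNReal.coe_lt_top ENNReal.ofReal_lt_top)).ne

lemma toReal_hausdorffMeasure_image_Ico (h : IsSimpleClosedCurve γ T) (ha : 0 ≤ a) (hab : a ≤ b)
    (hb : b ≤ T) : (μH[1] (γ '' Ico a b)).toReal = arcLength γ b - arcLength γ a := by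
  have hdisj : Disjoint (γ '' Ico 0 a) (γ '' Ico a b) := by
    rw [disjoint_iff_inter_eq_empty, ← h.injOn.image_inter (Ico_subset_Ico_right (hab.trans hb))
      (Ico_subset_Ico ha hb), Ico_disjoint_Ico_same.inter_eq, image_empty]
  rw [arcLength, arcLength, ← Ico_union_Ico_eq_Ico ha hab, image_union,
    measure_union hdisj (h.measurableSet_image_Ico ha hb),
    ENNReal.toReal_add (h.hausdorffMeasure_image_Ico_ne_top _ _)
      (h.hausdorffMeasure_image_Ico_ne_top _ _), add_sub_cancel_left]

lemma hausdorffMeasure_image_Ico (h : IsSimpleClosedCurve γ T) (ha : 0 ≤ a) (hab : a ≤ b)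
    (hb : b ≤ T) : μH[1] (γ '' Ico a b) = ENNReal.ofReal (arcLength γ b - arcLength γ a) := by
  rw [← h.toReal_hausdorffMeasure_image_Ico ha hab hb,
    ENNReal.ofReal_toReal (h.hausdorffMeasure_image_Ico_ne_top _ _)]

lemma dist_le_arcLength_sub (h : IsSimpleClosedCurve γ T) (ha : 0 ≤ a) (hab : a ≤ b)
    (hb : b ≤ T) : dist (γ a) (γ b) ≤ arcLength γ b - arcLength γ a := by
  rw [← h.toReal_hausdorffMeasure_image_Ico ha hab hb, dist_edist]
  exact ENNReal.toReal_mono (h.hausdorffMeasure_image_Ico_ne_top _ _)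
    (edist_le_hausdorffMeasure_image_Ico hab h.continuous.continuousOn)

lemma strictMonoOn_arcLength (h : IsSimpleClosedCurve γ T) :
    StrictMonoOn (arcLength γ) (Icc 0 T) := by
  intro a ha b hb hab
  obtain ⟨s, has, hsb⟩ := exists_between hab
  have hchord : 0 < dist (γ a) (γ s) := dist_pos.2 fun he =>
    has.ne (h.injOn ⟨ha.1, hab.trans_le hb.2⟩ ⟨ha.1.trans has.le, hsb.trans_le hb.2⟩ he)
  have hfirst := h.dist_le_arcLength_sub ha.1 has.le (hsb.le.trans hb.2)
  have hsecond := dist_nonneg.trans (h.dist_le_arcLength_sub (ha.1.trans has.le) hsb.le hb.2)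
  linarith

lemma continuousOn_arcLength (h : IsSimpleClosedCurve γ T) :
    ContinuousOn (arcLength γ) (Icc 0 T) := by
  obtain ⟨K, hK⟩ := h.exists_hausdorffMeasure_image_Ico_le
  refine (LipschitzOnWith.of_le_add_mul K fun b hb a ha => ?_).continuousOn
  rcases le_total a b with hab | hab
  · rw [← sub_le_iff_le_add', ← h.toReal_hausdorffMeasure_image_Ico ha.1 hab hb.2,
      Real.dist_eq, abs_of_nonneg (sub_nonneg.2 hab)]
    refine ENNReal.toReal_le_of_le_ofReal (by have := sub_nonneg.2 hab; positivity) ?_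
    rw [ENNReal.ofReal_mul K.coe_nonneg, ENNReal.ofReal_coe_nnreal]
    exact hK a b
  · exact (h.strictMonoOn_arcLength.monotoneOn hb ha hab).trans
      (le_add_of_nonneg_right (by positivity))

lemma surjOn_arcLength (h : IsSimpleClosedCurve γ T) :
    SurjOn (arcLength γ) (Icc 0 T) (Icc 0 (arcLength γ T)) := by
  simpa [SurjOn, arcLength] using intermediate_value_Icc h.nonneg h.continuousOn_arcLength

lemma exists_inverse_arcLength (h : IsSimpleClosedCurve γ T) :
    ∃ τ : ℝ → ℝ, MapsTo τ (Icc 0 (arcLength γ T)) (Icc 0 T) ∧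
      LeftInvOn (arcLength γ) τ (Icc 0 (arcLength γ T)) ∧ τ 0 = 0 ∧ τ (arcLength γ T) = T ∧
      ∀ ⦃a b⦄, 0 ≤ a → a ≤ b → b ≤ arcLength γ T → τ '' Ico a b = Ico (τ a) (τ b) := by
  have hmono := h.strictMonoOn_arcLength
  have hmaps := h.surjOn_arcLength.mapsTo_invFunOn
  have hinv := h.surjOn_arcLength.rightInvOn_invFunOn
  have hleft := hmono.injOn.leftInvOn_invFunOn
  have hzero : arcLength γ 0 = 0 := by simp [arcLength]
  have hmem {t : ℝ} (ht : t ∈ Icc 0 T) : arcLength γ t ∈ Icc 0 (arcLength γ T) :=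
    ⟨arcLength_nonneg γ t, hmono.monotoneOn ht (right_mem_Icc.2 h.nonneg) ht.2⟩
  set τ := Function.invFunOn (arcLength γ) (Icc 0 T)
  have hlt {p q : ℝ} (hp : p ∈ Icc 0 (arcLength γ T)) (hq : q ∈ Icc 0 (arcLength γ T)) :
      τ p < τ q ↔ p < q := by
    rw [← hmono.lt_iff_lt (hmaps hp) (hmaps hq), hinv hp, hinv hq]
  refine ⟨τ, hmaps, hinv, ?_, hleft (right_mem_Icc.2 h.nonneg), fun a b ha hab hb => ?_⟩
  · simpa only [hzero] using hleft (left_mem_Icc.2 h.nonneg)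
  have ha' : a ∈ Icc 0 (arcLength γ T) := ⟨ha, hab.trans hb⟩
  have hb' : b ∈ Icc 0 (arcLength γ T) := ⟨ha.trans hab, hb⟩
  refine Subset.antisymm ?_ fun t ht => ?_
  · rintro _ ⟨p, hp, rfl⟩
    have hp' : p ∈ Icc 0 (arcLength γ T) := ⟨ha.trans hp.1, hp.2.le.trans hb⟩
    exact ⟨not_lt.1 fun hpa => hp.1.not_gt ((hlt hp' ha').1 hpa), (hlt hp' hb').2 hp.2⟩
  · have ht' : t ∈ Icc 0 T := ⟨(hmaps ha').1.trans ht.1, ht.2.le.trans (hmaps hb').2⟩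
    rw [← hleft ht'] at ht ⊢
    exact ⟨_, ⟨not_lt.1 fun hta => ht.1.not_gt ((hlt (hmem ht') ha').2 hta),
      (hlt (hmem ht') hb').1 ht.2⟩, rfl⟩

lemma exists_isArcLengthParametrization (h : IsSimpleClosedCurve γ T) :
    ∃ σ, IsArcLengthParametrization (γ '' Ico 0 T) (arcLength γ T) σ := by
  obtain ⟨τ, hmaps, hinv, h0, hT, himage⟩ := h.exists_inverse_arcLength
  have hsub ⦃a b : ℝ⦄ (ha : 0 ≤ a) (hab : a ≤ b) (hb : b ≤ arcLength γ T) :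
      0 ≤ τ a ∧ τ a ≤ τ b ∧ τ b ≤ T ∧ arcLength γ (τ b) - arcLength γ (τ a) = b - a := by
    have ha' : a ∈ Icc 0 (arcLength γ T) := ⟨ha, hab.trans hb⟩
    have hb' : b ∈ Icc 0 (arcLength γ T) := ⟨ha.trans hab, hb⟩
    refine ⟨(hmaps ha').1, ?_, (hmaps hb').2, by rw [hinv ha', hinv hb']⟩
    rwa [← h.strictMonoOn_arcLength.le_iff_le (hmaps ha') (hmaps hb'), hinv ha', hinv hb']
  have hall : τ '' Ico 0 (arcLength γ T) = Ico 0 T := by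
    simpa only [h0, hT] using himage le_rfl (arcLength_nonneg γ T) le_rfl
  refine ⟨γ ∘ τ, by rw [image_comp, hall], ?_, by simp [h0, hT, h.closed], ?_,
    fun a b ha hab hb => ?_⟩
  · exact h.injOn.comp ((LeftInvOn.injOn hinv).mono Ico_subset_Icc_self)
      (mapsTo_iff_image_subset.2 hall.subset)
  · refine LipschitzOnWith.of_dist_le_mul fun a ha b hb => ?_
    wlog hab : a ≤ b generalizing a b
    · simpa only [dist_comm] using this b hb a ha (le_of_not_ge hab)
    obtain ⟨h1, h2, h3, h4⟩ := hsub ha.1 hab hb.2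
    rw [NNReal.coe_one, one_mul, dist_comm a, Real.dist_eq, abs_of_nonneg (sub_nonneg.2 hab), ← h4]
    exact h.dist_le_arcLength_sub h1 h2 h3
  · obtain ⟨h1, h2, h3, h4⟩ := hsub ha hab hb
    rw [image_comp, himage ha hab hb, h.hausdorffMeasure_image_Ico h1 h2 h3, h4]

end IsSimpleClosedCurve

end ArcLength

lemma IsConvexDomain.exists_isArcLengthParametrization {Ω : Set Plane} (h : IsConvexDomain Ω)
    (hne : Ω.Nonempty) :
    ∃ σ, IsArcLengthParametrization (frontier Ω) (boundaryLength Ω) σ := by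
  obtain ⟨c, hc⟩ := hne
  have hcurve : IsSimpleClosedCurve (boundaryCurve Ω c) (2 * Real.pi) :=
    ⟨Real.two_pi_pos.le, h.exists_lipschitzWith_boundaryCurve hc, h.injOn_boundaryCurve hc,
      boundaryCurve_two_pi Ω c⟩
  simpa only [boundaryLength, arcLength, h.image_boundaryCurve hc] using
      hcurve.exists_isArcLengthParametrization

/-! ### Inscribed polygons -/

lemma two_mul_dist_le_sum_range_dist {X : Type*} [PseudoMetricSpace X] {v : ℕ → X} {N i j : ℕ}
    (hv : v N = v 0) (hi : i ≤ N) (hj : j ≤ N) :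
    2 * dist (v i) (v j) ≤ ∑ k ∈ Finset.range N, dist (v k) (v (k + 1)) := by
  wlog hij : i ≤ j generalizing i j
  · simpa only [dist_comm] using this hj hi (le_of_not_ge hij)
  have hinner := dist_le_Ico_sum_dist v hij
  have houter : dist (v i) (v j) ≤ ∑ k ∈ Finset.range i, dist (v k) (v (k + 1)) +
      ∑ k ∈ Finset.Ico j N, dist (v k) (v (k + 1)) := by
    rw [dist_comm]
    refine (dist_triangle (v j) (v N) (v i)).trans ?_
    rw [hv, add_comm, ← hv]
    exact add_le_add (hv ▸ dist_le_range_sum_dist v i) (dist_le_Ico_sum_dist v hj)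
  rw [Finset.range_eq_Ico] at houter ⊢
  rw [← Finset.sum_Ico_consecutive _ (Nat.zero_le i) hi, ← Finset.sum_Ico_consecutive _ hij hj]
  linarith

lemma natCast_mul_div_mem_Icc {P : ℝ} {N k : ℕ} (hP : 0 ≤ P) (hk : k ≤ N) :
    (k * (P / N) : ℝ) ∈ Icc 0 P := by
  refine ⟨by positivity, ?_⟩
  rw [mul_div_left_comm]
  exact mul_le_of_le_one_right hP (div_le_one_of_le₀ (Nat.cast_le.2 hk) N.cast_nonneg)

lemma exists_mem_Ico_natCast_mul_div {P s : ℝ} {N : ℕ} (hN : 0 < N) (hs : s ∈ Ico 0 P) :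
    ∃ k < N, s ∈ Ico (k * (P / N)) ((k + 1 : ℕ) * (P / N)) := by
  have hℓ : 0 < P / N := div_pos (hs.1.trans_lt hs.2) (Nat.cast_pos.2 hN)
  have h0 : 0 ≤ s / (P / N) := div_nonneg hs.1 hℓ.le
  refine ⟨⌊s / (P / N)⌋₊, (Nat.floor_lt h0).2 ?_, ?_, ?_⟩
  · rw [div_lt_iff₀ hℓ, mul_div_cancel₀ _ (Nat.cast_ne_zero.2 hN.ne')]
    exact hs.2
  · exact (le_div_iff₀ hℓ).1 (Nat.floor_le h0)
  · rw [Nat.cast_succ]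
    exact (div_lt_iff₀ hℓ).1 (Nat.lt_floor_add_one _)

/-- The `k`-th vertex of the inscribed polygon that divides a closed curve of length `P`,
parametrized by arc length, into `N` arcs of equal length. -/
noncomputable def polygonVertex {X : Type*} (σ : ℝ → X) (P : ℝ) (N k : ℕ) : X := σ (k * (P / N))

/-- The `k`-th arc cut off by the inscribed polygon with vertices `polygonVertex σ P N k`; it
contains its initial point but not its final point, so that the arcs are disjoint. -/
def polygonArc {X : Type*} (σ : ℝ → X) (P : ℝ) (N k : ℕ) : Set X :=
  σ '' Ico (k * (P / N)) ((k + 1 : ℕ) * (P / N))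

/-- The perimeter of the inscribed polygon with vertices `polygonVertex σ P N k`. -/
noncomputable def polygonLength {X : Type*} [PseudoMetricSpace X] (σ : ℝ → X) (P : ℝ) (N : ℕ) :
    ℝ :=
  ∑ k ∈ Finset.range N, dist (polygonVertex σ P N k) (polygonVertex σ P N (k + 1))

namespace IsArcLengthParametrization

section Metric

variable {X : Type*} [MetricSpace X] [MeasurableSpace X] [BorelSpace X] {Γ : Set X} {P : ℝ}
  {σ : ℝ → X} {N k : ℕ}

lemma dist_le (h : IsArcLengthParametrization Γ P σ) {a b : ℝ} (ha : a ∈ Icc 0 P)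
    (hb : b ∈ Icc 0 P) : dist (σ a) (σ b) ≤ |a - b| := by
  simpa [Real.dist_eq] using h.lipschitzOnWith.dist_le_mul a ha b hb

lemma dist_polygonVertex_le (h : IsArcLengthParametrization Γ P σ) (hP : 0 ≤ P) (hk : k < N)
    {s : ℝ} (hs : s ∈ Icc (k * (P / N)) ((k + 1 : ℕ) * (P / N))) :
    dist (polygonVertex σ P N k) (σ s) ≤ P / N := by
  have hfst := natCast_mul_div_mem_Icc hP hk.le
  have hsnd := natCast_mul_div_mem_Icc hP (Nat.succ_le_of_lt hk)
  refine (h.dist_le hfst ⟨hfst.1.trans hs.1, hs.2.trans hsnd.2⟩).trans ?_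
  have hs2 := hs.2
  rw [Nat.cast_succ, add_one_mul] at hs2
  rw [abs_sub_comm, abs_of_nonneg (sub_nonneg.2 hs.1)]
  linarith

lemma polygonLength_le (h : IsArcLengthParametrization Γ P σ) (hP : 0 ≤ P) :
    polygonLength σ P N ≤ P := by
  rcases N.eq_zero_or_pos with rfl | hN
  · simpa [polygonLength] using hP
  calc polygonLength σ P N ≤ ∑ _k ∈ Finset.range N, P / N :=
        Finset.sum_le_sum fun k hk =>
          h.dist_polygonVertex_le hP (Finset.mem_range.1 hk)
            (right_mem_Icc.2 (by gcongr; simp))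
    _ = P := by
        rw [Finset.sum_const, Finset.card_range, nsmul_eq_mul,
          mul_div_cancel₀ _ (Nat.cast_ne_zero.2 hN.ne')]

lemma two_mul_dist_comp_le (h : IsArcLengthParametrization Γ P σ) {g : X → ℝ}
    (hg : LipschitzWith 1 g) (hN : 0 < N) {p q : X} (hp : p ∈ Γ) (hq : q ∈ Γ) :
    2 * dist (g p) (g q) ≤ ∑ k ∈ Finset.range N,
      dist (g (polygonVertex σ P N k)) (g (polygonVertex σ P N (k + 1))) + 4 * (P / N) := by
  have hnear : ∀ p ∈ Γ, ∃ k ≤ N, dist (g (polygonVertex σ P N k)) (g p) ≤ P / N := by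
    rw [← h.image_Ico]
    rintro _ ⟨s, hs, rfl⟩
    obtain ⟨k, hk, hsk⟩ := exists_mem_Ico_natCast_mul_div hN hs
    exact ⟨k, hk.le, (hg.dist_le_mul _ _).trans (by
      simpa using h.dist_polygonVertex_le (hs.1.trans hs.2.le) hk (Ico_subset_Icc_self hsk))⟩
  obtain ⟨i, hi, hpi⟩ := hnear p hp
  obtain ⟨j, hj, hqj⟩ := hnear q hq
  have hclosed : g (polygonVertex σ P N N) = g (polygonVertex σ P N 0) := by
    rw [polygonVertex, polygonVertex, mul_div_cancel₀ _ (Nat.cast_ne_zero.2 hN.ne'), h.closed,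
      Nat.cast_zero, zero_mul]
  have hpolygon :=
    two_mul_dist_le_sum_range_dist (v := fun k => g (polygonVertex σ P N k)) hclosed hi hj
  have htriangle :=
    dist_triangle4 (g p) (g (polygonVertex σ P N i)) (g (polygonVertex σ P N j)) (g q)
  rw [dist_comm (g p) (g (polygonVertex σ P N i))] at htriangle
  linarith

end Metric

variable {Γ : Set Plane} {P : ℝ} {σ : ℝ → Plane} {N : ℕ}

lemma two_mul_volume_image_normalCoord_le (h : IsArcLengthParametrization Γ P σ) (hP : 0 ≤ P)
    (hN : 0 < N) (φ : ℝ) :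
    2 * volume (normalCoord φ '' Γ) ≤ ∑ k ∈ Finset.range N,
      ENNReal.ofReal |normalCoord φ (polygonVertex σ P N k - polygonVertex σ P N (k + 1))| +
        ENNReal.ofReal (4 * (P / N)) := by
  rw [← ENNReal.ofReal_sum_of_nonneg fun _ _ => abs_nonneg _,
    ← ENNReal.ofReal_add (Finset.sum_nonneg fun _ _ => abs_nonneg _) (by positivity), mul_comm,
    ← ENNReal.le_div_iff_mul_le (by simp) (by simp)]
  refine (Real.volume_le_diam _).trans (Metric.ediam_le ?_)
  rintro _ ⟨p, hp, rfl⟩ _ ⟨q, hq, rfl⟩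
  have hpolygon := h.two_mul_dist_comp_le (lipschitzWith_normalCoord φ) hN hp hq
  rw [ENNReal.le_div_iff_mul_le (by simp) (by simp), edist_dist]
  calc ENNReal.ofReal (dist (normalCoord φ p) (normalCoord φ q)) * 2
      = ENNReal.ofReal (2 * dist (normalCoord φ p) (normalCoord φ q)) := by
        rw [ENNReal.ofReal_mul zero_le_two, ENNReal.ofReal_ofNat, mul_comm]
    _ ≤ _ := ENNReal.ofReal_le_ofReal (by simpa only [Real.dist_eq, map_sub] using hpolygon)

lemma two_mul_kinematicMeasure_linesMeeting_le (h : IsArcLengthParametrization Γ P σ)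
    (hP : 0 ≤ P) (hN : 0 < N) (hΓ : IsCompact Γ) :
    2 * kinematicMeasure (linesMeeting Γ) ≤
      ENNReal.ofReal (4 * polygonLength σ P N + 8 * Real.pi * (P / N)) := by
  rw [kinematicMeasure_apply (isClosed_linesMeeting hΓ).measurableSet,
    ← lintegral_const_mul' _ _ (by simp)]
  calc ∫⁻ φ in Ico 0 (2 * Real.pi), 2 * volume (normalCoord φ '' Γ)
      ≤ ∫⁻ φ in Ico 0 (2 * Real.pi), (∑ k ∈ Finset.range N,
          ENNReal.ofReal |normalCoord φ (polygonVertex σ P N k - polygonVertex σ P N (k + 1))| +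
            ENNReal.ofReal (4 * (P / N))) :=
        lintegral_mono fun φ => h.two_mul_volume_image_normalCoord_le hP hN φ
    _ = ENNReal.ofReal (4 * polygonLength σ P N + 8 * Real.pi * (P / N)) := by
        have hmeas (v : Plane) : Measurable fun φ => ENNReal.ofReal |normalCoord φ v| :=
          ENNReal.measurable_ofReal.comp (continuous_normalCoord_uncurry.comp
            (Continuous.prodMk_left v)).abs.measurable
        rw [lintegral_add_right _ measurable_const, lintegral_finsetSum _ fun k _ => hmeas _,
          setLIntegral_const_angle, ← ENNReal.ofReal_mul (by positivity)]
        simp only [lintegral_abs_normalCoord]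
        rw [← ENNReal.ofReal_sum_of_nonneg fun _ _ => by positivity,
          ← ENNReal.ofReal_add (Finset.sum_nonneg fun _ _ => by positivity) (by positivity),
          polygonLength, Finset.mul_sum]
        congr 2
        ring

lemma kinematicMeasure_linesMeeting_le (h : IsArcLengthParametrization Γ P σ)
    (hP : 0 ≤ P) (hΓ : IsCompact Γ) :
    kinematicMeasure (linesMeeting Γ) ≤ ENNReal.ofReal (2 * P) := by
  have hlim : Tendsto (fun n : ℕ => ENNReal.ofReal (4 * P + 8 * Real.pi * (P / n))) atTop
      (𝓝 (ENNReal.ofReal (4 * P))) := by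
    refine ENNReal.tendsto_ofReal ?_
    simpa using
      ((tendsto_const_div_atTop_nhds_zero_nat P).const_mul (8 * Real.pi)).const_add (4 * P)
  have hle : 2 * kinematicMeasure (linesMeeting Γ) ≤ ENNReal.ofReal (4 * P) := by
    refine ge_of_tendsto hlim ((eventually_gt_atTop 0).mono fun N hN => ?_)
    refine (h.two_mul_kinematicMeasure_linesMeeting_le hP hN hΓ).trans ?_
    gcongr
    exact h.polygonLength_le hP
  rw [show 4 * P = 2 * (2 * P) by ring, ENNReal.ofReal_mul zero_le_two, ENNReal.ofReal_ofNat] at hle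
  exact (ENNReal.mul_le_mul_iff_right two_ne_zero ENNReal.ofNat_ne_top).1 hle

end IsArcLengthParametrization

lemma support_multiplicityOne (A : Set Plane) : {x | multiplicityOne A x ≠ 0} = A := by
  ext x
  simp [multiplicityOne]

lemma mem_linesMeeting_iff_nonempty {A : Set Plane} {q : ℝ × ℝ} :
    q ∈ linesMeeting A ↔ (lineOf q ∩ A).Nonempty :=
  exists_congr fun x => by rw [mem_inter_iff, mem_lineOf, and_comm]

lemma intersectionNumber_multiplicityOne (A : Set Plane) (q : ℝ × ℝ) :
    intersectionNumber (multiplicityOne A) q = (lineOf q ∩ A).encard := by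
  rw [intersectionNumber]
  simp only [natCast_multiplicityOne]
  rw [tsum_subtype (lineOf q), indicator_indicator, ← tsum_subtype]
  exact ENNReal.tsum_set_one _

lemma intersectionNumber_eq_top_or_natCast (θ : Plane → ℕ) (q : ℝ × ℝ) :
    intersectionNumber θ q = ⊤ ∨ ∃ m : ℕ, intersectionNumber θ q = m := by
  refine or_iff_not_imp_left.2 fun h => ?_
  have hf := ENNReal.finite_const_le_of_tsum_ne_top h one_ne_zero
  refine ⟨∑ x ∈ hf.toFinset, θ x, ?_⟩
  rw [intersectionNumber, tsum_eq_sum (s := hf.toFinset), Nat.cast_sum]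
  intro x hx
  simpa only [Finite.mem_toFinset, mem_ofPred_eq, not_le, Nat.cast_lt_one, Nat.cast_eq_zero]
    using hx

lemma two_mul_add_one_mul_le_sq_add (k m : ℕ) : (2 * k + 1) * m ≤ m ^ 2 + k * (k + 1) := by
  zify
  rcases le_or_gt (m : ℤ) k with hmk | hmk <;> nlinarith

lemma two_mul_add_one_mul_intersectionNumber_le (θ : Plane → ℕ) (q : ℝ × ℝ) (k : ℕ) :
    (2 * k + 1) * intersectionNumber θ q ≤ intersectionNumber θ q ^ 2 + k * (k + 1) := by
  rcases intersectionNumber_eq_top_or_natCast θ q with htop | ⟨m, hm⟩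
  · simp [htop]
  · rw [hm]
    exact_mod_cast two_mul_add_one_mul_le_sq_add k m

lemma ae_intersectionNumber_segment (a b : Plane) :
    ∀ᵐ q ∂kinematicMeasure, intersectionNumber (multiplicityOne (segment ℝ a b)) q =
      (linesMeeting (segment ℝ a b)).indicator 1 q := by
  have ha : kinematicMeasure (linesMeeting {a}) = 0 :=
    kinematicMeasure_linesMeeting_eq_zero
      ((Measure.nullSingletonClass_hausdorff Plane one_pos).measure_singleton a)
  filter_upwards [measure_eq_zero_iff_ae_notMem.1 ha] with q hq
  have hsub : (lineOf q ∩ segment ℝ a b).Subsingleton := by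
    rw [segment_eq_image']
    rintro _ ⟨hs, s, -, rfl⟩ _ ⟨ht, t, -, rfl⟩
    simp only [mem_lineOf, map_add, map_smul, smul_eq_mul] at hs ht
    have hba : normalCoord q.1 (b - a) ≠ 0 := fun h0 => hq ⟨a, rfl, by simpa [h0] using hs⟩
    rw [mul_right_cancel₀ hba (add_left_cancel (hs.trans ht.symm))]
  rw [intersectionNumber_multiplicityOne]
  rcases hsub.eq_empty_or_singleton with h | ⟨x, h⟩
  · rw [indicator_of_notMem fun hmem => (mem_linesMeeting_iff_nonempty.1 hmem).ne_empty h, h]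
    simp
  · rw [indicator_of_mem (mem_linesMeeting_iff_nonempty.2 (h ▸ singleton_nonempty x)), h]
    simp

lemma IsOneRectifiable.union {S T : Set Plane} (hS : IsOneRectifiable S)
    (hT : IsOneRectifiable T) : IsOneRectifiable (S ∪ T) := by
  obtain ⟨hSm, f, hf, hf0⟩ := hS
  obtain ⟨hTm, g, hg, hg0⟩ := hT
  refine ⟨hSm.union hTm, fun k => Sum.elim f g (Equiv.natSumNatEquivNat.symm k), fun k => ?_, ?_⟩
  · change ∃ K, LipschitzWith K (Sum.elim f g _)
    rcases Equiv.natSumNatEquivNat.symm k with i | i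
    exacts [hf i, hg i]
  · rw [Equiv.natSumNatEquivNat.symm.surjective.iUnion_comp fun k => range (Sum.elim f g k),
      iUnion_sum, union_sdiff_distrib]
    exact measure_union_null (measure_mono_null (sdiff_subset_sdiff_right subset_union_left) hf0)
      (measure_mono_null (sdiff_subset_sdiff_right subset_union_right) hg0)

lemma isOneRectifiable_segment (a b : Plane) : IsOneRectifiable (segment ℝ a b) := by
  refine ⟨(isCompact_segment a b).measurableSet.nullMeasurableSet,
    fun _ => AffineMap.lineMap a b, fun _ => ⟨_, lipschitzWith_lineMap a b⟩, ?_⟩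
  rw [iUnion_const, segment_eq_image_lineMap, sdiff_eq_empty.2 (image_subset_range _ _),
    measure_empty]

namespace IsConvexDomain

variable {Ω : Set Plane}

lemma ofReal_boundaryLength (h : IsConvexDomain Ω) (hne : Ω.Nonempty) :
    ENNReal.ofReal (boundaryLength Ω) = μH[1] (frontier Ω) := by
  obtain ⟨σ, hσ⟩ := h.exists_isArcLengthParametrization hne
  have hlength := hσ.hausdorffMeasure_image_Ico (b := boundaryLength Ω) le_rfl
    ENNReal.toReal_nonneg le_rfl
  rwa [hσ.image_Ico, sub_zero, eq_comm] at hlength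

lemma hausdorffMeasure_frontier_ne_top (h : IsConvexDomain Ω) (hne : Ω.Nonempty) :
    μH[1] (frontier Ω) ≠ ⊤ :=
  h.ofReal_boundaryLength hne ▸ ENNReal.ofReal_ne_top

lemma boundaryLength_pos (h : IsConvexDomain Ω) (hne : Ω.Nonempty) : 0 < boundaryLength Ω := by
  refine ENNReal.toReal_nonneg.lt_of_ne' fun h0 => ?_
  obtain ⟨σ, hσ⟩ := h.exists_isArcLengthParametrization hne
  obtain ⟨c, hc⟩ := hne
  have hmem := h.boundaryCurve_mem_frontier hc 0
  rw [← hσ.image_Ico, boundaryLength, h0] at hmem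
  simp at hmem

lemma isOneRectifiable_frontier (h : IsConvexDomain Ω) (hne : Ω.Nonempty) :
    IsOneRectifiable (frontier Ω) := by
  obtain ⟨c, hc⟩ := hne
  refine ⟨isClosed_frontier.measurableSet.nullMeasurableSet, fun _ => boundaryCurve Ω c,
    fun _ => h.exists_lipschitzWith_boundaryCurve hc, ?_⟩
  rw [iUnion_const, ← h.image_boundaryCurve hc, sdiff_eq_empty.2 (image_subset_range _ _),
    measure_empty]

lemma ae_intersectionNumber_eq_zero (h : IsConvexDomain Ω) {θ : Plane → ℕ}
    (hθ : {x | θ x ≠ 0} ⊆ closure Ω) :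
    ∀ᵐ q ∂kinematicMeasure, q ∉ linesMeeting Ω → intersectionNumber θ q = 0 := by
  filter_upwards [h.ae_mem_linesMeeting] with q hq hqΩ
  refine ENNReal.tsum_eq_zero.2 fun x => ?_
  by_contra hx
  exact hqΩ (hq ⟨x, hθ (Nat.cast_ne_zero.1 hx), mem_lineOf.1 x.2⟩)

lemma linesMeeting_subset_linesMeeting_frontier (h : IsConvexDomain Ω) :
    linesMeeting Ω ⊆ linesMeeting (frontier Ω) := fun q hq => by
  obtain ⟨y, z, -, hyz⟩ := h.exists_lineOf_inter_frontier_eq hq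
  exact mem_linesMeeting_iff_nonempty.2 (hyz ▸ insert_nonempty y {z})

lemma intersectionNumber_frontier (h : IsConvexDomain Ω) {q : ℝ × ℝ} (hq : q ∈ linesMeeting Ω) :
    intersectionNumber (multiplicityOne (frontier Ω)) q = 2 := by
  obtain ⟨y, z, hne, hyz⟩ := h.exists_lineOf_inter_frontier_eq hq
  rw [intersectionNumber_multiplicityOne, hyz, encard_pair hne, ENat.toENNReal_ofNat]

lemma ae_intersectionNumber_frontier (h : IsConvexDomain Ω) :
    ∀ᵐ q ∂kinematicMeasure, intersectionNumber (multiplicityOne (frontier Ω)) q =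
      (linesMeeting Ω).indicator (fun _ => 2) q := by
  filter_upwards [h.ae_intersectionNumber_eq_zero
    ((support_multiplicityOne _).trans_subset frontier_subset_closure)] with q hq0
  by_cases hq : q ∈ linesMeeting Ω
  · rw [indicator_of_mem hq, h.intersectionNumber_frontier hq]
  · rw [indicator_of_notMem hq, hq0 hq]

lemma kinematicMeasure_linesMeeting (h : IsConvexDomain Ω) (hne : Ω.Nonempty) :
    kinematicMeasure (linesMeeting Ω) = 2 * μH[1] (frontier Ω) := by
  apply le_antisymm
  · obtain ⟨σ, hσ⟩ := h.exists_isArcLengthParametrization hne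
    rw [← h.ofReal_boundaryLength hne, ← ENNReal.ofReal_ofNat 2, ← ENNReal.ofReal_mul zero_le_two]
    exact (measure_mono h.linesMeeting_subset_linesMeeting_frontier).trans
      (hσ.kinematicMeasure_linesMeeting_le ENNReal.toReal_nonneg
        h.isCompact_frontier)
  · have hcrofton := (h.isOneRectifiable_frontier hne).four_mul_hausdorffMeasure_le_lintegral
      (h.hausdorffMeasure_frontier_ne_top hne)
    rw [lintegral_congr_ae h.ae_intersectionNumber_frontier,
      lintegral_indicator_const h.measurableSet_linesMeeting,
      show (4 : ℝ≥0∞) = 2 * 2 by norm_num, mul_assoc] at hcrofton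
    exact (ENNReal.mul_le_mul_iff_right two_ne_zero ENNReal.ofNat_ne_top).1 hcrofton

lemma kinematicMeasure_linesMeeting_eq_ofReal (h : IsConvexDomain Ω) (hne : Ω.Nonempty) :
    kinematicMeasure (linesMeeting Ω) = ENNReal.ofReal (2 * boundaryLength Ω) := by
  rw [h.kinematicMeasure_linesMeeting hne, ← h.ofReal_boundaryLength hne,
    ENNReal.ofReal_mul zero_le_two, ENNReal.ofReal_ofNat]

lemma two_mul_dist_le_boundaryLength (h : IsConvexDomain Ω) (hne : Ω.Nonempty) {a b : Plane}
    (ha : a ∈ closure Ω) (hb : b ∈ closure Ω) : 2 * dist a b ≤ boundaryLength Ω := by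
  have hsub : segment ℝ a b ⊆ closure Ω := h.convex.closure.segment_subset ha hb
  have hle : kinematicMeasure (linesMeeting (segment ℝ a b)) ≤ kinematicMeasure (linesMeeting Ω) :=
    measure_mono_ae (h.ae_mem_linesMeeting.mono fun q hq hqs => hq (linesMeeting_mono hsub hqs))
  rw [kinematicMeasure_linesMeeting_segment, h.kinematicMeasure_linesMeeting_eq_ofReal hne,
    ENNReal.ofReal_le_ofReal_iff (mul_nonneg zero_le_two (h.boundaryLength_pos hne).le)] at hle
  linarith

lemma two_mul_add_one_mul_multisetLength_le (h : IsConvexDomain Ω) (hne : Ω.Nonempty)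
    {θ : Plane → ℕ} (hθ : IsOneRectifiableMultiset θ) (hsupp : {x | θ x ≠ 0} ⊆ closure Ω)
    (hfin : multisetLength θ ≠ ⊤) (k : ℕ) :
    (2 * k + 1) * (4 * multisetLength θ) ≤
      (∫⁻ q, intersectionNumber θ q ^ 2 ∂kinematicMeasure) +
        k * (k + 1) * (2 * μH[1] (frontier Ω)) := by
  have hpointwise : ∀ᵐ q ∂kinematicMeasure, (2 * k + 1) * intersectionNumber θ q ≤
      intersectionNumber θ q ^ 2 +
        (linesMeeting Ω).indicator (fun _ => (k * (k + 1) : ℝ≥0∞)) q := by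
    filter_upwards [h.ae_intersectionNumber_eq_zero hsupp] with q hq0
    by_cases hq : q ∈ linesMeeting Ω
    · rw [indicator_of_mem hq]
      exact two_mul_add_one_mul_intersectionNumber_le θ q k
    · simp [hq0 hq]
  calc (2 * k + 1) * (4 * multisetLength θ)
      ≤ (2 * k + 1) * ∫⁻ q, intersectionNumber θ q ∂kinematicMeasure := by
        gcongr
        exact hθ.four_mul_multisetLength_le_lintegral hfin
    _ ≤ ∫⁻ q, (2 * k + 1) * intersectionNumber θ q ∂kinematicMeasure :=
        lintegral_const_mul_le _ _
    _ ≤ ∫⁻ q, (intersectionNumber θ q ^ 2 +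
          (linesMeeting Ω).indicator (fun _ => (k * (k + 1) : ℝ≥0∞)) q) ∂kinematicMeasure :=
        lintegral_mono_ae hpointwise
    _ = _ := by
        rw [lintegral_add_right _ (measurable_const.indicator h.measurableSet_linesMeeting),
          lintegral_indicator_const h.measurableSet_linesMeeting,
          h.kinematicMeasure_linesMeeting hne]

lemma ofReal_le_croftonEnergy (h : IsConvexDomain Ω) (hne : Ω.Nonempty) {L : ℝ}
    {θ : Plane → ℕ} (hθ : IsCompetitor Ω L θ) (k : ℕ) :
    ENNReal.ofReal ((2 * k + 1) * L - k * (k + 1) * boundaryLength Ω / 2) ≤ croftonEnergy θ := by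
  obtain ⟨hrect, hsupp, hlen⟩ := hθ
  have hP := (h.boundaryLength_pos hne).le
  have hineq := h.two_mul_add_one_mul_multisetLength_le hne hrect hsupp
    (hlen ▸ ENNReal.ofReal_ne_top) k
  rw [croftonEnergy, ENNReal.le_div_iff_mul_le (by simp) (by simp), ← ENNReal.ofReal_ofNat 4,
    ← ENNReal.ofReal_mul' (by norm_num), show ((2 * k + 1) * L - k * (k + 1) * boundaryLength Ω / 2)
      * 4 = (2 * k + 1) * (4 * L) - k * (k + 1) * (2 * boundaryLength Ω) by ring,
    ENNReal.ofReal_sub _ (by positivity), tsub_le_iff_right]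
  rw [hlen, ← h.ofReal_boundaryLength hne] at hineq
  have hodd : ENNReal.ofReal ((2 * k + 1 : ℕ) : ℝ) = 2 * k + 1 := by
    rw [ENNReal.ofReal_natCast]; push_cast; rfl
  have hprod : ENNReal.ofReal ((k * (k + 1) : ℕ) : ℝ) = k * (k + 1) := by
    rw [ENNReal.ofReal_natCast]; push_cast; rfl
  push_cast at hodd hprod
  rwa [ENNReal.ofReal_mul (by positivity), ENNReal.ofReal_mul zero_le_four,
    ENNReal.ofReal_mul (by positivity), ENNReal.ofReal_mul zero_le_two, hodd, hprod,
    ENNReal.ofReal_ofNat, ENNReal.ofReal_ofNat]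

end IsConvexDomain

/-! ### Copies of the boundary together with another set -/

/-- The union of `n` copies of the boundary of `Ω` with the set `B`, with multiplicity. For a
segment `B` this is definitionally `copiesWithSegment`. -/
noncomputable def copiesWith (Ω : Set Plane) (n : ℕ) (B : Set Plane) : Plane → ℕ :=
  fun x => n * multiplicityOne (frontier Ω) x + multiplicityOne B x

lemma intersectionNumber_copiesWith (Ω : Set Plane) (n : ℕ) (B : Set Plane) (q : ℝ × ℝ) :
    intersectionNumber (copiesWith Ω n B) q =
      n * intersectionNumber (multiplicityOne (frontier Ω)) q +
        intersectionNumber (multiplicityOne B) q := by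
  simp only [intersectionNumber, copiesWith, Nat.cast_add, Nat.cast_mul]
  rw [ENNReal.tsum_add, ENNReal.tsum_mul_left]

lemma multisetLength_copiesWith (Ω : Set Plane) (n : ℕ) {B : Set Plane}
    (hB : NullMeasurableSet B (μH[1] : Measure Plane)) :
    multisetLength (copiesWith Ω n B) = n * μH[1] (frontier Ω) + μH[1] B := by
  have hfm : MeasurableSet (frontier Ω) := isClosed_frontier.measurableSet
  simp only [multisetLength, copiesWith, Nat.cast_add, Nat.cast_mul, natCast_multiplicityOne]
  rw [lintegral_add_left ((measurable_one.indicator hfm).const_mul _),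
    lintegral_const_mul _ (measurable_one.indicator hfm), lintegral_indicator_one hfm,
    lintegral_indicator_one₀ hB]

lemma support_copiesWith_subset (Ω : Set Plane) (n : ℕ) (B : Set Plane) :
    {x | copiesWith Ω n B x ≠ 0} ⊆ frontier Ω ∪ B := fun x hx => by
  by_contra hx'
  rw [mem_union, not_or] at hx'
  exact hx (by simp [copiesWith, multiplicityOne, hx'])

namespace IsConvexDomain

variable {Ω B : Set Plane} {r : ℝ}

lemma isCompetitor_copiesWith (h : IsConvexDomain Ω) (hne : Ω.Nonempty) (n : ℕ)
    (hBΩ : B ⊆ closure Ω) (hB : IsOneRectifiable B) (hr : 0 ≤ r)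
    (hBr : μH[1] B = ENNReal.ofReal r) :
    IsCompetitor Ω (n * boundaryLength Ω + r) (copiesWith Ω n B) := by
  have hone {A : Set Plane} (hA : NullMeasurableSet A (μH[1] : Measure Plane)) :
      AEMeasurable (multiplicityOne A) (μH[1] : Measure Plane) := aemeasurable_one.indicator₀ hA
  have hmeas : NullMeasurable (copiesWith Ω n B) (μH[1] : Measure Plane) :=
    ((aemeasurable_const.mul (hone isClosed_frontier.measurableSet.nullMeasurableSet)).add
      (hone hB.1)).nullMeasurable
  have hsupp := support_copiesWith_subset Ω n B
  refine ⟨⟨hmeas, ?_⟩, hsupp.trans (union_subset frontier_subset_closure hBΩ), ?_⟩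
  · have hpreimage := hmeas (measurableSet_singleton (0 : ℕ)).compl
    exact ((h.isOneRectifiable_frontier hne).union hB).mono hsupp hpreimage
  · have hP := (h.boundaryLength_pos hne).le
    rw [multisetLength_copiesWith Ω n hB.1, hBr, ← h.ofReal_boundaryLength hne,
      ENNReal.ofReal_add (by positivity) hr, ENNReal.ofReal_mul n.cast_nonneg,
      ENNReal.ofReal_natCast]

lemma lintegral_sq_intersectionNumber_copiesWith (h : IsConvexDomain Ω) (hne : Ω.Nonempty) (n : ℕ)
    {D : Set (ℝ × ℝ)} (hBΩ : B ⊆ closure Ω) (hD : NullMeasurableSet D kinematicMeasure)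
    (hm : AEMeasurable (intersectionNumber (multiplicityOne B)) kinematicMeasure)
    (hsq : ∀ᵐ q ∂kinematicMeasure, intersectionNumber (multiplicityOne B) q ^ 2 =
      intersectionNumber (multiplicityOne B) q + D.indicator (fun _ => 2) q) :
    ∫⁻ q, intersectionNumber (copiesWith Ω n B) q ^ 2 ∂kinematicMeasure =
      4 * n ^ 2 * (2 * μH[1] (frontier Ω)) +
        (4 * n + 1) * (∫⁻ q, intersectionNumber (multiplicityOne B) q ∂kinematicMeasure) +
          2 * kinematicMeasure D := by
  have hpointwise : ∀ᵐ q ∂kinematicMeasure, intersectionNumber (copiesWith Ω n B) q ^ 2 =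
      (linesMeeting Ω).indicator (fun _ => (4 * n ^ 2 : ℝ≥0∞)) q +
        (4 * n + 1) * intersectionNumber (multiplicityOne B) q + D.indicator (fun _ => 2) q := by
    filter_upwards [h.ae_intersectionNumber_frontier, hsq,
      h.ae_intersectionNumber_eq_zero ((support_multiplicityOne B).trans_subset hBΩ)]
      with q hfront hsq hzero
    rw [intersectionNumber_copiesWith, hfront, add_assoc, add_one_mul, add_assoc, ← hsq]
    by_cases hq : q ∈ linesMeeting Ω
    · simp only [indicator_of_mem hq]
      ring
    · simp [indicator_of_notMem hq, hzero hq]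
  rw [lintegral_congr_ae hpointwise,
    lintegral_add_right' _ (aemeasurable_const.indicator₀ hD),
    lintegral_add_left (measurable_const.indicator h.measurableSet_linesMeeting),
    lintegral_indicator_const h.measurableSet_linesMeeting, lintegral_indicator_const₀ hD,
    lintegral_const_mul'' _ hm, h.kinematicMeasure_linesMeeting hne]

lemma croftonEnergy_copiesWith (h : IsConvexDomain Ω) (hne : Ω.Nonempty) (n : ℕ)
    {D : Set (ℝ × ℝ)} (hBΩ : B ⊆ closure Ω) (hr : 0 ≤ r) (hBr : μH[1] B = ENNReal.ofReal r)
    (hD : NullMeasurableSet D kinematicMeasure)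
    (hm : AEMeasurable (intersectionNumber (multiplicityOne B)) kinematicMeasure)
    (hint : ∫⁻ q, intersectionNumber (multiplicityOne B) q ∂kinematicMeasure = 4 * μH[1] B)
    (hsq : ∀ᵐ q ∂kinematicMeasure, intersectionNumber (multiplicityOne B) q ^ 2 =
      intersectionNumber (multiplicityOne B) q + D.indicator (fun _ => 2) q) :
    croftonEnergy (copiesWith Ω n B) =
      ENNReal.ofReal (2 * n ^ 2 * boundaryLength Ω + (4 * n + 1) * r) + kinematicMeasure D / 2 := by
  have hP := (h.boundaryLength_pos hne).le
  have hn : ENNReal.ofReal (4 * n + 1) = 4 * n + 1 := by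
    rw [ENNReal.ofReal_add (by positivity) zero_le_one, ENNReal.ofReal_mul zero_le_four]
    simp
  rw [croftonEnergy, h.lintegral_sq_intersectionNumber_copiesWith hne n hBΩ hD hm hsq, hint, hBr,
    ← h.ofReal_boundaryLength hne, ENNReal.ofReal_add (by positivity) (by positivity),
    ENNReal.ofReal_mul (by positivity), ENNReal.ofReal_mul (by positivity),
    ENNReal.ofReal_mul (by positivity), hn, ENNReal.ofReal_pow n.cast_nonneg,
    ENNReal.ofReal_natCast, ENNReal.ofReal_ofNat]
  have htwo : 2 * kinematicMeasure D = 4 * (kinematicMeasure D / 2) := by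
    rw [show (4 : ℝ≥0∞) = 2 * 2 by norm_num, mul_assoc,
      ENNReal.mul_div_cancel two_ne_zero ENNReal.ofNat_ne_top]
  rw [htwo, eq_comm, ENNReal.eq_div_iff four_ne_zero ENNReal.ofNat_ne_top]
  ring

lemma croftonEnergy_copiesWith_segment (h : IsConvexDomain Ω) (hne : Ω.Nonempty) (n : ℕ)
    {a b : Plane} (ha : a ∈ closure Ω) (hb : b ∈ closure Ω) :
    croftonEnergy (copiesWith Ω n (segment ℝ a b)) =
      ENNReal.ofReal (2 * n ^ 2 * boundaryLength Ω + (4 * n + 1) * dist a b) := by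
  have hms : MeasurableSet (linesMeeting (segment ℝ a b)) :=
    (isClosed_linesMeeting (isCompact_segment a b)).measurableSet
  have hae := ae_intersectionNumber_segment a b
  have hlength : μH[1] (segment ℝ a b) = ENNReal.ofReal (dist a b) := by
    rw [hausdorffMeasure_segment, edist_dist]
  rw [h.croftonEnergy_copiesWith hne n (D := ∅) (h.convex.closure.segment_subset ha hb)
    dist_nonneg hlength .empty
    ((measurable_one.indicator hms).aemeasurable.congr (hae.mono fun _ hq => hq.symm)) ?_ ?_]
  · simp
  · rw [lintegral_congr_ae hae, lintegral_indicator_one hms, kinematicMeasure_linesMeeting_segment,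
      hlength, ENNReal.ofReal_mul zero_le_four, ENNReal.ofReal_ofNat]
  · filter_upwards [hae] with q hq
    by_cases hmem : q ∈ linesMeeting (segment ℝ a b) <;> simp [hq, hmem]

lemma isCompetitor_copiesWithSegment (h : IsConvexDomain Ω) (hne : Ω.Nonempty) (n : ℕ)
    {a b : Plane} (ha : a ∈ closure Ω) (hb : b ∈ closure Ω) :
    IsCompetitor Ω (n * boundaryLength Ω + dist a b) (copiesWithSegment Ω n a b) :=
  h.isCompetitor_copiesWith hne n (h.convex.closure.segment_subset ha hb)
    (isOneRectifiable_segment a b) dist_nonneg (by rw [hausdorffMeasure_segment, edist_dist])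

lemma exists_dist_eq (h : IsConvexDomain Ω) (hne : Ω.Nonempty) {s : ℝ} (hs : 0 ≤ s)
    (hsd : s ≤ Metric.diam Ω) : ∃ a ∈ closure Ω, ∃ b ∈ closure Ω, dist a b = s := by
  have hcompact : IsCompact (closure Ω ×ˢ closure Ω) :=
    h.isBounded.isCompact_closure.prod h.isBounded.isCompact_closure
  have hconn : IsPreconnected (closure Ω ×ˢ closure Ω) :=
    h.convex.closure.isPreconnected.prod h.convex.closure.isPreconnected
  have hcont : ContinuousOn (fun z : Plane × Plane => dist z.1 z.2) (closure Ω ×ˢ closure Ω) :=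
    continuous_dist.continuousOn
  obtain ⟨⟨a, b⟩, hab, hmax⟩ := hcompact.exists_isMaxOn (hne.closure.prod hne.closure) hcont
  have hdiam : Metric.diam Ω ≤ dist a b := Metric.diam_le_of_forall_dist_le dist_nonneg
    fun x hx y hy => isMaxOn_iff.1 hmax (x, y) ⟨subset_closure hx, subset_closure hy⟩
  obtain ⟨⟨x, y⟩, hxy, rfl⟩ := hconn.intermediate_value (a := (a, a)) ⟨hab.1, hab.1⟩ hab hcont
    ⟨by simpa using hs, hsd.trans hdiam⟩
  exact ⟨x, hxy.1, y, hxy.2, rfl⟩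

end IsConvexDomain

/-! ### Sparse subfamilies -/

lemma sum_sum_powersetCard_erase {α : Type*} [DecidableEq α] (S : Finset α) (k : ℕ)
    (w : Finset α → ℝ≥0∞) :
    ∑ i ∈ S, ∑ e ∈ (S.erase i).powersetCard k, w e =
      (S.card - k : ℕ) * ∑ e ∈ S.powersetCard k, w e := by
  have hcomm : ∑ i ∈ S, ∑ e ∈ (S.erase i).powersetCard k, w e =
      ∑ e ∈ S.powersetCard k, ∑ _i ∈ S \ e, w e := by
    refine Finset.sum_comm' fun i e => ?_
    simp only [Finset.mem_powersetCard, Finset.mem_sdiff, Finset.subset_erase]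
    tauto
  rw [hcomm, Finset.mul_sum]
  refine Finset.sum_congr rfl fun e he => ?_
  obtain ⟨heS, hek⟩ := Finset.mem_powersetCard.1 he
  rw [Finset.sum_const, Finset.card_sdiff_of_subset heS, hek, nsmul_eq_mul]

lemma exists_subset_card_eq_choose_mul_sum_powersetCard_le {α : Type*} (T : Finset α)
    (k : ℕ) (w : Finset α → ℝ≥0∞) {m : ℕ} (hm : m ≤ T.card) :
    ∃ S ⊆ T, S.card = m ∧ T.card.choose k * ∑ e ∈ S.powersetCard k, w e ≤
      m.choose k * ∑ e ∈ T.powersetCard k, w e := by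
  classical
  induction hm using Nat.decreasingInduction with
  | self => exact ⟨T, subset_rfl, rfl, le_rfl⟩
  | of_succ m _ ih =>
    obtain ⟨S, hST, hcard, hS⟩ := ih
    have hne : S.Nonempty := Finset.card_pos.1 (hcard ▸ m.succ_pos)
    obtain ⟨i, hi, hle⟩ : ∃ i ∈ S, (m + 1 : ℕ) * ∑ e ∈ (S.erase i).powersetCard k, w e ≤
        (m + 1 - k : ℕ) * ∑ e ∈ S.powersetCard k, w e := by
      refine ENNReal.exists_le_of_sum_le hne ?_
      rw [← Finset.mul_sum, sum_sum_powersetCard_erase, Finset.sum_const, hcard, nsmul_eq_mul]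
    refine ⟨S.erase i, (Finset.erase_subset i S).trans hST, by
      rw [Finset.card_erase_of_mem hi, hcard, Nat.add_sub_cancel], ?_⟩
    refine (ENNReal.mul_le_mul_iff_right (Nat.cast_ne_zero.2 m.succ_ne_zero)
      (ENNReal.natCast_ne_top (m + 1))).1 ?_
    calc (m + 1 : ℕ) * (T.card.choose k * ∑ e ∈ (S.erase i).powersetCard k, w e)
        = T.card.choose k * ((m + 1 : ℕ) * ∑ e ∈ (S.erase i).powersetCard k, w e) := by ring
      _ ≤ T.card.choose k * ((m + 1 - k : ℕ) * ∑ e ∈ S.powersetCard k, w e) := by gcongr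
      _ = (m + 1 - k : ℕ) * (T.card.choose k * ∑ e ∈ S.powersetCard k, w e) := by ring
      _ ≤ (m + 1 - k : ℕ) * ((m + 1).choose k * ∑ e ∈ T.powersetCard k, w e) := by gcongr
      _ = (m + 1 : ℕ) * (m.choose k * ∑ e ∈ T.powersetCard k, w e) := by
        rw [← mul_assoc, ← mul_assoc, ← Nat.cast_mul, ← Nat.cast_mul, mul_comm (m + 1 - k),
          ← Nat.choose_mul_succ_eq, mul_comm (m + 1)]

lemma choose_two_mul_sq_le {m N : ℕ} (h : m ≤ N) :
    m.choose 2 * N ^ 2 ≤ N.choose 2 * m ^ 2 := by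
  have hcast : (m.choose 2 : ℚ) * N ^ 2 ≤ N.choose 2 * m ^ 2 := by
    rw [Nat.cast_choose_two, Nat.cast_choose_two]
    have hnonneg : (0 : ℚ) ≤ m * N * (N - m) :=
      mul_nonneg (by positivity) (sub_nonneg.2 (Nat.cast_le.2 h))
    linarith
  exact_mod_cast hcast

lemma exists_subset_card_eq_sq_mul_sum_pairs_le {α : Type*} (T : Finset α)
    (w : Finset α → ℝ≥0∞) {m : ℕ} (hm : m ≤ T.card) :
    ∃ S ⊆ T, S.card = m ∧ (T.card : ℝ≥0∞) ^ 2 * ∑ e ∈ S.powersetCard 2, w e ≤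
      (m : ℝ≥0∞) ^ 2 * ∑ e ∈ T.powersetCard 2, w e := by
  obtain ⟨S, hST, hcard, hS⟩ := exists_subset_card_eq_choose_mul_sum_powersetCard_le T 2 w hm
  refine ⟨S, hST, hcard, ?_⟩
  rcases lt_or_ge T.card 2 with hT | hT
  · rw [Finset.powersetCard_eq_empty.2 ((Finset.card_le_card hST).trans_lt hT)]
    simp
  refine (ENNReal.mul_le_mul_iff_right (Nat.cast_ne_zero.2 (Nat.choose_pos hT).ne')
    (ENNReal.natCast_ne_top (T.card.choose 2))).1 ?_
  calc (T.card.choose 2 : ℝ≥0∞) * (T.card ^ 2 * ∑ e ∈ S.powersetCard 2, w e)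
      = T.card ^ 2 * (T.card.choose 2 * ∑ e ∈ S.powersetCard 2, w e) := by ring
    _ ≤ T.card ^ 2 * (m.choose 2 * ∑ e ∈ T.powersetCard 2, w e) := by gcongr
    _ = (m.choose 2 * T.card ^ 2 : ℕ) * ∑ e ∈ T.powersetCard 2, w e := by push_cast; ring
    _ ≤ (T.card.choose 2 * m ^ 2 : ℕ) * ∑ e ∈ T.powersetCard 2, w e := by
      gcongr ?_ * _
      exact Nat.cast_le.2 (choose_two_mul_sq_le hm)
    _ = T.card.choose 2 * (m ^ 2 * ∑ e ∈ T.powersetCard 2, w e) := by push_cast; ring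

/-! ### Subsets of the boundary -/

/-- The lines through `Ω` that meet the boundary of `Ω` only inside `A`; when `A` is part of that
boundary, these are the lines that meet `A` twice. -/
def linesCaughtBy (Ω A : Set Plane) : Set (ℝ × ℝ) := linesMeeting Ω \ linesMeeting (frontier Ω \ A)

lemma linesCaughtBy_mono {Ω A B : Set Plane} (h : A ⊆ B) :
    linesCaughtBy Ω A ⊆ linesCaughtBy Ω B :=
  sdiff_subset_sdiff_right (linesMeeting_mono (sdiff_subset_sdiff_right h))

namespace IsConvexDomain

variable {Ω A : Set Plane}

lemma nullMeasurableSet_linesMeeting_of_subset (h : IsConvexDomain Ω) (hne : Ω.Nonempty)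
    (hA : A ⊆ frontier Ω) (hAm : MeasurableSet A) :
    NullMeasurableSet (linesMeeting A) kinematicMeasure :=
  nullMeasurableSet_linesMeeting hAm.nullMeasurableSet
    (measure_ne_top_of_subset hA (h.hausdorffMeasure_frontier_ne_top hne))

lemma nullMeasurableSet_linesCaughtBy (h : IsConvexDomain Ω) (hne : Ω.Nonempty)
    (hAm : MeasurableSet A) : NullMeasurableSet (linesCaughtBy Ω A) kinematicMeasure :=
  h.measurableSet_linesMeeting.nullMeasurableSet.diff
    (h.nullMeasurableSet_linesMeeting_of_subset hne sdiff_subset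
      (isClosed_frontier.measurableSet.diff hAm))

lemma ae_intersectionNumber_of_subset_frontier (h : IsConvexDomain Ω) (hA : A ⊆ frontier Ω) :
    ∀ᵐ q ∂kinematicMeasure, intersectionNumber (multiplicityOne A) q =
      (linesMeeting A).indicator 1 q + (linesCaughtBy Ω A).indicator 1 q := by
  filter_upwards [h.ae_mem_linesMeeting] with q hclosure
  rw [intersectionNumber_multiplicityOne]
  by_cases hq : q ∈ linesMeeting Ω
  · obtain ⟨y, z, hne, hyz⟩ := h.exists_lineOf_inter_frontier_eq hq
    have hinter : lineOf q ∩ A = {y, z} ∩ A := by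
      rw [← hyz, inter_assoc, inter_eq_self_of_subset_right hA]
    have hmeet : q ∈ linesMeeting A ↔ y ∈ A ∨ z ∈ A := by
      rw [mem_linesMeeting_iff_nonempty, hinter]
      simp [Set.Nonempty]
    have hcaught : q ∈ linesCaughtBy Ω A ↔ y ∈ A ∧ z ∈ A := by
      rw [linesCaughtBy, Set.mem_sdiff, mem_linesMeeting_iff_nonempty (A := _ \ _),
        ← inter_sdiff_assoc, hyz, not_nonempty_iff_eq_empty, sdiff_eq_empty]
      simp [hq, pair_subset_iff]
    rw [hinter]
    by_cases hy : y ∈ A <;> by_cases hz : z ∈ A <;>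
      simp [indicator, hmeet, hcaught, hy, hz, insert_inter_of_mem, insert_inter_of_notMem,
        encard_pair hne, one_add_one_eq_two]
  · have hmeet : q ∉ linesMeeting A := fun hqA =>
      hq (hclosure (linesMeeting_mono (hA.trans frontier_subset_closure) hqA))
    rw [indicator_of_notMem hmeet, indicator_of_notMem fun hcaught => hq hcaught.1]
    rw [mem_linesMeeting_iff_nonempty, not_nonempty_iff_eq_empty] at hmeet
    simp [hmeet]

lemma linesCaughtBy_subset_linesMeeting (h : IsConvexDomain Ω) :
    linesCaughtBy Ω A ⊆ linesMeeting A := by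
  rintro q ⟨hq, hcaught⟩
  obtain ⟨x, hx, hxq⟩ := h.linesMeeting_subset_linesMeeting_frontier hq
  exact ⟨x, by_contra fun hxA => hcaught ⟨x, ⟨hx, hxA⟩, hxq⟩, hxq⟩

lemma ae_sq_intersectionNumber_of_subset_frontier (h : IsConvexDomain Ω) (hA : A ⊆ frontier Ω) :
    ∀ᵐ q ∂kinematicMeasure, intersectionNumber (multiplicityOne A) q ^ 2 =
      intersectionNumber (multiplicityOne A) q + (linesCaughtBy Ω A).indicator (fun _ => 2) q := by
  filter_upwards [h.ae_intersectionNumber_of_subset_frontier hA] with q hq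
  rw [hq]
  by_cases hcaught : q ∈ linesCaughtBy Ω A
  · simp only [indicator_of_mem hcaught,
      indicator_of_mem (h.linesCaughtBy_subset_linesMeeting hcaught), Pi.one_apply]
    norm_num
  · by_cases hmeet : q ∈ linesMeeting A <;> simp [hcaught, hmeet]

lemma aemeasurable_intersectionNumber_of_subset_frontier (h : IsConvexDomain Ω)
    (hne : Ω.Nonempty) (hA : A ⊆ frontier Ω) (hAm : MeasurableSet A) :
    AEMeasurable (intersectionNumber (multiplicityOne A)) kinematicMeasure := by
  have hsum : AEMeasurable (fun q => (linesMeeting A).indicator (1 : ℝ × ℝ → ℝ≥0∞) q +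
      (linesCaughtBy Ω A).indicator 1 q) kinematicMeasure :=
    (aemeasurable_one.indicator₀ (h.nullMeasurableSet_linesMeeting_of_subset hne hA hAm)).add
      (aemeasurable_one.indicator₀ (h.nullMeasurableSet_linesCaughtBy hne hAm))
  exact hsum.congr ((h.ae_intersectionNumber_of_subset_frontier hA).mono fun _ hq => hq.symm)

lemma lintegral_intersectionNumber_of_subset_frontier (h : IsConvexDomain Ω) (hne : Ω.Nonempty)
    (hA : A ⊆ frontier Ω) (hAm : MeasurableSet A) :
    ∫⁻ q, intersectionNumber (multiplicityOne A) q ∂kinematicMeasure = 4 * μH[1] A := by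
  have hfin := h.hausdorffMeasure_frontier_ne_top hne
  have hle {B : Set Plane} (hB : B ⊆ frontier Ω) (hBm : MeasurableSet B) :
      4 * μH[1] B ≤ ∫⁻ q, intersectionNumber (multiplicityOne B) q ∂kinematicMeasure :=
    ((h.isOneRectifiable_frontier hne).mono hB
      hBm.nullMeasurableSet).four_mul_hausdorffMeasure_le_lintegral
        (measure_ne_top_of_subset hB hfin)
  have hadd (q : ℝ × ℝ) : intersectionNumber (multiplicityOne (frontier Ω)) q =
      intersectionNumber (multiplicityOne A) q +
        intersectionNumber (multiplicityOne (frontier Ω \ A)) q := by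
    simp only [intersectionNumber_multiplicityOne]
    rw [← ENat.toENNReal_add, ← encard_union_eq (disjoint_sdiff_right.mono inter_subset_right
      inter_subset_right), ← inter_union_distrib_left, union_sdiff_cancel hA]
  have htotal : ∫⁻ q, intersectionNumber (multiplicityOne A) q ∂kinematicMeasure +
      ∫⁻ q, intersectionNumber (multiplicityOne (frontier Ω \ A)) q ∂kinematicMeasure =
        4 * μH[1] A + 4 * μH[1] (frontier Ω \ A) := by
    rw [← lintegral_add_left' (h.aemeasurable_intersectionNumber_of_subset_frontier hne hA hAm),
      ← lintegral_congr hadd, lintegral_congr_ae h.ae_intersectionNumber_frontier,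
      lintegral_indicator_const h.measurableSet_linesMeeting, h.kinematicMeasure_linesMeeting hne,
      ← mul_add, measure_add_sdiff hAm.nullMeasurableSet, union_eq_self_of_subset_left hA,
      ← mul_assoc]
    norm_num
  refine (hle hA hAm).antisymm' ?_
  rw [← ENNReal.add_le_add_iff_right (ENNReal.mul_ne_top (a := 4) (by simp)
    (measure_ne_top_of_subset (sdiff_subset (t := A)) hfin)), ← htotal]
  gcongr
  exact hle sdiff_subset (isClosed_frontier.measurableSet.diff hAm)

lemma kinematicMeasure_linesMeeting_add_linesCaughtBy (h : IsConvexDomain Ω) (hne : Ω.Nonempty)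
    (hA : A ⊆ frontier Ω) (hAm : MeasurableSet A) :
    kinematicMeasure (linesMeeting A) + kinematicMeasure (linesCaughtBy Ω A) = 4 * μH[1] A := by
  have hmeet := h.nullMeasurableSet_linesMeeting_of_subset hne hA hAm
  have hindicator : AEMeasurable ((linesMeeting A).indicator (1 : ℝ × ℝ → ℝ≥0∞))
      kinematicMeasure := aemeasurable_one.indicator₀ hmeet
  rw [← h.lintegral_intersectionNumber_of_subset_frontier hne hA hAm,
    lintegral_congr_ae (h.ae_intersectionNumber_of_subset_frontier hA),
    lintegral_add_left' hindicator, lintegral_indicator_one₀ hmeet,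
    lintegral_indicator_one₀ (h.nullMeasurableSet_linesCaughtBy hne hAm)]

lemma croftonEnergy_copiesWith_of_subset_frontier (h : IsConvexDomain Ω) (hne : Ω.Nonempty)
    (n : ℕ) (hA : A ⊆ frontier Ω) (hAm : MeasurableSet A) {r : ℝ} (hr : 0 ≤ r)
    (hAr : μH[1] A = ENNReal.ofReal r) :
    croftonEnergy (copiesWith Ω n A) =
      ENNReal.ofReal (2 * n ^ 2 * boundaryLength Ω + (4 * n + 1) * r) +
        kinematicMeasure (linesCaughtBy Ω A) / 2 :=
  h.croftonEnergy_copiesWith hne n (hA.trans frontier_subset_closure) hr hAr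
    (h.nullMeasurableSet_linesCaughtBy hne hAm)
    (h.aemeasurable_intersectionNumber_of_subset_frontier hne hA hAm)
    (h.lintegral_intersectionNumber_of_subset_frontier hne hA hAm)
    (h.ae_sq_intersectionNumber_of_subset_frontier hA)

variable {ι : Type*} {B : ι → Set Plane}

lemma linesCaughtBy_biUnion_subset (h : IsConvexDomain Ω) (S : Finset ι) :
    linesCaughtBy Ω (⋃ i ∈ S, B i) ⊆ (⋃ i ∈ S, linesCaughtBy Ω (B i)) ∪
      ⋃ e ∈ S.powersetCard 2, linesMeeting Ω ∩ ⋂ i ∈ e, linesMeeting (B i) := by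
  classical
  rintro q ⟨hq, hcaught⟩
  obtain ⟨y, z, -, hyz⟩ := h.exists_lineOf_inter_frontier_eq hq
  have hmem : ∀ x ∈ lineOf q ∩ frontier Ω, ∃ i ∈ S, x ∈ B i := by
    rintro x ⟨hxq, hx⟩
    by_contra! hxB
    exact hcaught ⟨x, ⟨hx, by simpa using hxB⟩, mem_lineOf.1 hxq⟩
  have hy : y ∈ lineOf q ∩ frontier Ω := hyz ▸ mem_insert y {z}
  have hz : z ∈ lineOf q ∩ frontier Ω := hyz ▸ mem_insert_of_mem y rfl
  obtain ⟨i, hi, hyi⟩ := hmem y hy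
  obtain ⟨j, hj, hzj⟩ := hmem z hz
  by_cases hij : i = j
  · subst hij
    refine Or.inl (mem_iUnion₂.2 ⟨i, hi, hq, ?_⟩)
    rintro ⟨x, ⟨hx, hxi⟩, hxq⟩
    rcases (hyz ▸ ⟨mem_lineOf.2 hxq, hx⟩ : x ∈ ({y, z} : Set Plane)) with rfl | rfl
    exacts [hxi hyi, hxi hzj]
  · refine Or.inr (mem_iUnion₂.2 ⟨{i, j}, Finset.mem_powersetCard.2
      ⟨Finset.insert_subset hi (Finset.singleton_subset_iff.2 hj), Finset.card_pair hij⟩, hq, ?_⟩)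
    simp only [mem_iInter, Finset.mem_insert, Finset.mem_singleton]
    rintro k (rfl | rfl)
    exacts [⟨y, hyi, mem_lineOf.1 hy.1⟩, ⟨z, hzj, mem_lineOf.1 hz.1⟩]

lemma card_le_two_of_mem_linesMeeting (h : IsConvexDomain Ω) {T : Finset ι}
    (hB : ∀ i ∈ T, B i ⊆ frontier Ω) (hdisj : (T : Set ι).PairwiseDisjoint B) {q : ℝ × ℝ}
    (hq : q ∈ linesMeeting Ω) (hqB : ∀ i ∈ T, q ∈ linesMeeting (B i)) : T.card ≤ 2 := by
  classical
  obtain ⟨y, z, -, hyz⟩ := h.exists_lineOf_inter_frontier_eq hq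
  have hmem : ∀ i ∈ T, ∃ x ∈ ({y, z} : Finset Plane), x ∈ B i := fun i hi => by
    obtain ⟨x, hx, hxq⟩ := hqB i hi
    have hxyz : x ∈ ({y, z} : Set Plane) := hyz ▸ ⟨mem_lineOf.2 hxq, hB i hi hx⟩
    exact ⟨x, by simpa using hxyz, hx⟩
  choose! x hx hxB using hmem
  refine (Finset.card_le_card_of_injOn x hx fun i hi j hj hij => ?_).trans Finset.card_le_two
  exact hdisj.elim_set hi hj (x i) (hxB i hi) (hij ▸ hxB j hj)

lemma sum_pairs_kinematicMeasure_le (h : IsConvexDomain Ω) (hne : Ω.Nonempty) {T : Finset ι}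
    (hB : ∀ i ∈ T, B i ⊆ frontier Ω) (hBm : ∀ i ∈ T, MeasurableSet (B i))
    (hdisj : (T : Set ι).PairwiseDisjoint B) :
    ∑ e ∈ T.powersetCard 2, kinematicMeasure (linesMeeting Ω ∩ ⋂ i ∈ e, linesMeeting (B i)) ≤
      kinematicMeasure (linesMeeting Ω) := by
  classical
  rw [← measure_biUnion_finset₀]
  · exact measure_mono (iUnion₂_subset fun e _ => inter_subset_left)
  · refine fun e he e' he' hee' => Disjoint.aedisjoint (disjoint_left.2 fun q hq hq' => hee' ?_)
    obtain ⟨heT, hcard⟩ := Finset.mem_powersetCard.1 he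
    obtain ⟨heT', hcard'⟩ := Finset.mem_powersetCard.1 he'
    have hunion : e ∪ e' ⊆ T := Finset.union_subset heT heT'
    have hle : (e ∪ e').card ≤ 2 := h.card_le_two_of_mem_linesMeeting
      (fun i hi => hB i (hunion hi)) (hdisj.subset (Finset.coe_subset.2 hunion)) hq.1
      fun i hi => (Finset.mem_union.1 hi).elim (fun hi => mem_iInter₂.1 hq.2 i hi)
        fun hi => mem_iInter₂.1 hq'.2 i hi
    exact (Finset.eq_of_subset_of_card_le Finset.subset_union_left (hle.trans hcard.ge)).trans
      (Finset.eq_of_subset_of_card_le Finset.subset_union_right (hle.trans hcard'.ge)).symm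
  · intro e he
    have heT := (Finset.mem_powersetCard.1 he).1
    exact h.measurableSet_linesMeeting.nullMeasurableSet.inter
      (NullMeasurableSet.biInter e.countable_toSet fun i hi =>
        h.nullMeasurableSet_linesMeeting_of_subset hne (hB i (heT hi)) (hBm i (heT hi)))

end IsConvexDomain

namespace IsArcLengthParametrization

section Arc

variable {X : Type*} [MetricSpace X] [MeasurableSpace X] [BorelSpace X] {Γ : Set X} {P a b : ℝ}
  {σ : ℝ → X} {N k : ℕ}

lemma image_Ico_subset (h : IsArcLengthParametrization Γ P σ) (ha : 0 ≤ a) (hb : b ≤ P) :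
    σ '' Ico a b ⊆ Γ :=
  (image_mono (Ico_subset_Ico ha hb)).trans_eq h.image_Ico

lemma measurableSet_image_Ico (h : IsArcLengthParametrization Γ P σ) (ha : 0 ≤ a) (hb : b ≤ P) :
    MeasurableSet (σ '' Ico a b) :=
  measurableSet_Ico.image_of_continuousOn_injOn
    (h.lipschitzOnWith.continuousOn.mono (Ico_subset_Icc_self.trans (Icc_subset_Icc ha hb)))
    (h.injOn.mono (Ico_subset_Ico ha hb))

lemma polygonArc_subset (h : IsArcLengthParametrization Γ P σ) (hP : 0 ≤ P) (hk : k < N) :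
    polygonArc σ P N k ⊆ Γ :=
  h.image_Ico_subset (natCast_mul_div_mem_Icc hP hk.le).1 (natCast_mul_div_mem_Icc hP hk).2

lemma measurableSet_polygonArc (h : IsArcLengthParametrization Γ P σ) (hP : 0 ≤ P) (hk : k < N) :
    MeasurableSet (polygonArc σ P N k) :=
  h.measurableSet_image_Ico (natCast_mul_div_mem_Icc hP hk.le).1 (natCast_mul_div_mem_Icc hP hk).2

lemma hausdorffMeasure_polygonArc (h : IsArcLengthParametrization Γ P σ) (hP : 0 ≤ P)
    (hk : k < N) : μH[1] (polygonArc σ P N k) = ENNReal.ofReal (P / N) := by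
  rw [polygonArc, h.hausdorffMeasure_image_Ico (natCast_mul_div_mem_Icc hP hk.le).1
    (by gcongr; exact k.le_succ) (natCast_mul_div_mem_Icc hP hk).2, Nat.cast_succ, add_one_mul,
    add_sub_cancel_left]

lemma pairwiseDisjoint_polygonArc (h : IsArcLengthParametrization Γ P σ) (hP : 0 ≤ P) :
    (Finset.range N : Set ℕ).PairwiseDisjoint (polygonArc σ P N) := by
  intro i hi j hj hij
  rw [Finset.coe_range, mem_Iio] at hi hj
  have hsub {k : ℕ} (hk : k < N) : Ico (k * (P / N)) ((k + 1 : ℕ) * (P / N)) ⊆ Ico 0 P :=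
    Ico_subset_Ico (natCast_mul_div_mem_Icc hP hk.le).1 (natCast_mul_div_mem_Icc hP hk).2
  have hmono : Monotone fun k : ℕ => (k * (P / N) : ℝ) := fun k l hkl => by
    change (k * (P / N) : ℝ) ≤ l * (P / N)
    gcongr
  exact (hmono.pairwise_disjoint_on_Ico_succ hij).image h.injOn (hsub hi) (hsub hj)

end Arc

variable {Γ : Set Plane} {P : ℝ} {σ : ℝ → Plane} {N k : ℕ}

lemma four_mul_dist_le_kinematicMeasure_linesMeeting_polygonArc
    (h : IsArcLengthParametrization Γ P σ) (hP : 0 ≤ P) (hk : k < N) :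
    ENNReal.ofReal (4 * dist (polygonVertex σ P N k) (polygonVertex σ P N (k + 1))) ≤
      kinematicMeasure (linesMeeting (polygonArc σ P N k)) := by
  have hle : (k * (P / N) : ℝ) ≤ (k + 1 : ℕ) * (P / N) := by gcongr; exact k.le_succ
  have hcont : ContinuousOn σ (Icc (k * (P / N)) ((k + 1 : ℕ) * (P / N))) :=
    h.lipschitzOnWith.continuousOn.mono (Icc_subset_Icc (natCast_mul_div_mem_Icc hP hk.le).1
      (natCast_mul_div_mem_Icc hP hk).2)
  have hsub : linesMeeting (segment ℝ (polygonVertex σ P N k) (polygonVertex σ P N (k + 1))) ⊆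
      linesMeeting (polygonArc σ P N k) ∪ linesMeeting {polygonVertex σ P N (k + 1)} := by
    rintro ⟨φ, p⟩ ⟨x, hx, hxp⟩
    have hp : p ∈ uIcc (normalCoord φ (polygonVertex σ P N k))
        (normalCoord φ (polygonVertex σ P N (k + 1))) := by
      rw [← image_normalCoord_segment]
      exact ⟨x, hx, hxp⟩
    obtain ⟨s, hs, hsp⟩ := intermediate_value_uIcc
      (((normalCoord φ).continuous.comp_continuousOn hcont).mono (uIcc_of_le hle).subset) hp
    rw [uIcc_of_le hle] at hs
    rw [← linesMeeting_union]
    refine ⟨σ s, ?_, hsp⟩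
    rcases hs.2.lt_or_eq with hlt | rfl
    exacts [Or.inl ⟨s, ⟨hs.1, hlt⟩, rfl⟩, Or.inr rfl]
  rw [← kinematicMeasure_linesMeeting_segment]
  refine (measure_mono hsub).trans ((measure_union_le _ _).trans_eq ?_)
  rw [kinematicMeasure_linesMeeting_eq_zero
    ((Measure.nullSingletonClass_hausdorff Plane one_pos).measure_singleton _), add_zero]

lemma exists_subset_biUnion_polygonArc {X : Type*} [MetricSpace X] [MeasurableSpace X]
    [BorelSpace X] {Γ : Set X} {P r : ℝ} {σ : ℝ → X} {N : ℕ}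
    (h : IsArcLengthParametrization Γ P σ) (hP : 0 ≤ P) (hr : 0 ≤ r) {S : Finset ℕ}
    (hS : S ⊆ Finset.range N) (hne : S.Nonempty) (hrS : r ≤ S.card * (P / N)) :
    ∃ A ⊆ ⋃ i ∈ S, polygonArc σ P N i, MeasurableSet A ∧ μH[1] A = ENNReal.ofReal r := by
  have hcard : (0 : ℝ) < S.card := Nat.cast_pos.2 hne.card_pos
  have hshort : r / S.card ≤ P / N := (div_le_iff₀' hcard).2 hrS
  have hbounds {i : ℕ} (hi : i ∈ S) : 0 ≤ (i * (P / N) : ℝ) ∧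
      i * (P / N) + r / S.card ≤ (i + 1 : ℕ) * (P / N) ∧ (i + 1 : ℕ) * (P / N) ≤ P := by
    have hiN := Finset.mem_range.1 (hS hi)
    refine ⟨(natCast_mul_div_mem_Icc hP hiN.le).1, ?_, (natCast_mul_div_mem_Icc hP hiN).2⟩
    rw [Nat.cast_succ, add_one_mul]
    gcongr
  have hsub {i : ℕ} (hi : i ∈ S) :
      σ '' Ico (i * (P / N)) (i * (P / N) + r / S.card) ⊆ polygonArc σ P N i :=
    image_mono (Ico_subset_Ico_right (hbounds hi).2.1)
  have hmeas {i : ℕ} (hi : i ∈ S) :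
      MeasurableSet (σ '' Ico (i * (P / N)) (i * (P / N) + r / S.card)) :=
    h.measurableSet_image_Ico (hbounds hi).1 ((hbounds hi).2.1.trans (hbounds hi).2.2)
  refine ⟨⋃ i ∈ S, σ '' Ico (i * (P / N)) (i * (P / N) + r / S.card),
    iUnion₂_mono fun i hi => hsub hi, S.measurableSet_biUnion fun i hi => hmeas hi, ?_⟩
  rw [measure_biUnion_finset (fun i hi j hj hij => ((h.pairwiseDisjoint_polygonArc hP).subset
    (Finset.coe_subset.2 hS) hi hj hij).mono (hsub hi) (hsub hj)) fun i hi => hmeas hi]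
  calc ∑ i ∈ S, μH[1] (σ '' Ico (i * (P / N)) (i * (P / N) + r / S.card))
      = ∑ _i ∈ S, ENNReal.ofReal (r / S.card) := Finset.sum_congr rfl fun i hi => by
        rw [h.hausdorffMeasure_image_Ico (hbounds hi).1 (le_add_of_nonneg_right (by positivity))
          ((hbounds hi).2.1.trans (hbounds hi).2.2), add_sub_cancel_left]
    _ = ENNReal.ofReal r := by
        rw [Finset.sum_const, ← ENNReal.ofReal_nsmul, nsmul_eq_mul, mul_div_cancel₀ r hcard.ne']

variable {Ω : Set Plane}

lemma sum_kinematicMeasure_linesCaughtBy_polygonArc_le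
    (hσ : IsArcLengthParametrization (frontier Ω) (boundaryLength Ω) σ) (h : IsConvexDomain Ω)
    (hne : Ω.Nonempty) (hN : 0 < N) :
    ∑ k ∈ Finset.range N, kinematicMeasure (linesCaughtBy Ω (polygonArc σ (boundaryLength Ω) N k)) ≤
      ENNReal.ofReal (8 * Real.pi * (boundaryLength Ω / N)) := by
  have hP := (h.boundaryLength_pos hne).le
  set P := boundaryLength Ω
  have harc {k : ℕ} (hk : k < N) :
      ENNReal.ofReal (4 * dist (polygonVertex σ P N k) (polygonVertex σ P N (k + 1))) +
        kinematicMeasure (linesCaughtBy Ω (polygonArc σ P N k)) ≤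
          ENNReal.ofReal (4 * (P / N)) := by
    rw [ENNReal.ofReal_mul (q := P / N) zero_le_four, ENNReal.ofReal_ofNat,
      ← hσ.hausdorffMeasure_polygonArc hP hk,
      ← h.kinematicMeasure_linesMeeting_add_linesCaughtBy hne (hσ.polygonArc_subset hP hk)
        (hσ.measurableSet_polygonArc hP hk)]
    gcongr
    exact hσ.four_mul_dist_le_kinematicMeasure_linesMeeting_polygonArc hP hk
  have hsum : ENNReal.ofReal (4 * polygonLength σ P N) +
      ∑ k ∈ Finset.range N, kinematicMeasure (linesCaughtBy Ω (polygonArc σ P N k)) ≤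
        ENNReal.ofReal (4 * P) := by
    rw [polygonLength, Finset.mul_sum, ENNReal.ofReal_sum_of_nonneg fun _ _ => by positivity,
      ← Finset.sum_add_distrib]
    refine (Finset.sum_le_sum fun k hk => harc (Finset.mem_range.1 hk)).trans_eq ?_
    rw [Finset.sum_const, Finset.card_range, ← ENNReal.ofReal_nsmul, nsmul_eq_mul]
    congr 1
    field_simp
  have htotal : ENNReal.ofReal (4 * P) ≤
      ENNReal.ofReal (4 * polygonLength σ P N) + ENNReal.ofReal (8 * Real.pi * (P / N)) := by
    have hlength : 0 ≤ polygonLength σ P N := Finset.sum_nonneg fun _ _ => dist_nonneg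
    rw [← ENNReal.ofReal_add (by positivity) (by positivity)]
    refine le_trans ?_ (hσ.two_mul_kinematicMeasure_linesMeeting_le hP hN h.isCompact_frontier)
    rw [show 4 * P = 2 * (2 * P) by ring, ENNReal.ofReal_mul zero_le_two, ENNReal.ofReal_ofNat,
      ← h.kinematicMeasure_linesMeeting_eq_ofReal hne]
    gcongr
    exact h.linesMeeting_subset_linesMeeting_frontier
  exact (ENNReal.add_le_add_iff_left ENNReal.ofReal_ne_top).1 (hsum.trans htotal)

lemma exists_sum_pairs_polygonArc_le
    (hσ : IsArcLengthParametrization (frontier Ω) (boundaryLength Ω) σ) (h : IsConvexDomain Ω)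
    (hne : Ω.Nonempty) (hN : 0 < N) {m : ℕ} (hm : m ≤ N) :
    ∃ S ⊆ Finset.range N, S.card = m ∧
      ∑ e ∈ S.powersetCard 2, kinematicMeasure
        (linesMeeting Ω ∩ ⋂ i ∈ e, linesMeeting (polygonArc σ (boundaryLength Ω) N i)) ≤
        ENNReal.ofReal (2 * boundaryLength Ω * (m / N) ^ 2) := by
  have hP := (h.boundaryLength_pos hne).le
  set P := boundaryLength Ω
  obtain ⟨S, hS, hcard, hle⟩ := exists_subset_card_eq_sq_mul_sum_pairs_le (Finset.range N)
    (fun e => kinematicMeasure (linesMeeting Ω ∩ ⋂ i ∈ e, linesMeeting (polygonArc σ P N i)))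
    (hm.trans_eq (Finset.card_range N).symm)
  refine ⟨S, hS, hcard, ?_⟩
  rw [Finset.card_range] at hle
  rw [← ENNReal.mul_le_mul_iff_right (a := (N : ℝ≥0∞) ^ 2) (by positivity) (by simp)]
  have hpairs := h.sum_pairs_kinematicMeasure_le hne (T := Finset.range N)
    (fun i hi => hσ.polygonArc_subset hP (Finset.mem_range.1 hi))
    (fun i hi => hσ.measurableSet_polygonArc hP (Finset.mem_range.1 hi))
    (hσ.pairwiseDisjoint_polygonArc hP)
  calc _ ≤ (m : ℝ≥0∞) ^ 2 * kinematicMeasure (linesMeeting Ω) := hle.trans (by gcongr)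
    _ = ENNReal.ofReal ((m : ℝ) ^ 2 * (2 * P)) := by
      rw [h.kinematicMeasure_linesMeeting_eq_ofReal hne,
        ENNReal.ofReal_mul (q := 2 * P) (by positivity),
        ENNReal.ofReal_pow m.cast_nonneg, ENNReal.ofReal_natCast]
    _ = ENNReal.ofReal ((N : ℝ) ^ 2 * (2 * P * (m / N) ^ 2)) := by
      congr 1
      field_simp
    _ = _ := by
      rw [ENNReal.ofReal_mul (by positivity), ENNReal.ofReal_pow N.cast_nonneg,
        ENNReal.ofReal_natCast]

end IsArcLengthParametrization

namespace IsConvexDomain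

variable {Ω : Set Plane} {L r : ℝ} {n N : ℕ}

lemma exists_subset_frontier_kinematicMeasure_linesCaughtBy_le (h : IsConvexDomain Ω)
    (hne : Ω.Nonempty) (hr : 0 ≤ r) (hrP : r < boundaryLength Ω) (hN : 0 < N) :
    ∃ A ⊆ frontier Ω, MeasurableSet A ∧ μH[1] A = ENNReal.ofReal r ∧
      kinematicMeasure (linesCaughtBy Ω A) ≤
        ENNReal.ofReal (8 * Real.pi * (boundaryLength Ω / N) +
          2 * boundaryLength Ω * (r / boundaryLength Ω + 1 / N) ^ 2) := by
  have hP := h.boundaryLength_pos hne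
  obtain ⟨σ, hσ⟩ := h.exists_isArcLengthParametrization hne
  set P := boundaryLength Ω
  have hN' : (0 : ℝ) < N := Nat.cast_pos.2 hN
  have hratio : 0 ≤ r / P * N := by positivity
  have hm : ⌊r / P * N⌋₊ + 1 ≤ N := (Nat.floor_lt hratio).2
    (mul_lt_of_lt_one_left hN' ((div_lt_one hP).2 hrP))
  obtain ⟨S, hS, hcard, hpairs⟩ := hσ.exists_sum_pairs_polygonArc_le h hne hN hm
  have hrS : r ≤ S.card * (P / N) := by
    have hlt := Nat.lt_floor_add_one (r / P * N)
    rw [← div_le_iff₀ (by positivity), div_div_eq_mul_div, mul_div_right_comm, hcard, Nat.cast_succ]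
    exact hlt.le
  have hsparse : ((⌊r / P * N⌋₊ + 1 : ℕ) : ℝ) / N ≤ r / P + 1 / N := by
    rw [Nat.cast_succ, add_div]
    exact add_le_add_left (div_le_of_le_mul₀ hN'.le (by positivity) (Nat.floor_le hratio)) _
  obtain ⟨A, hA, hAm, hAr⟩ := hσ.exists_subset_biUnion_polygonArc hP.le hr hS
    (Finset.card_pos.1 (hcard ▸ Nat.succ_pos _)) hrS
  refine ⟨A, hA.trans (iUnion₂_subset fun i hi =>
    hσ.polygonArc_subset hP.le (Finset.mem_range.1 (hS hi))), hAm, hAr, ?_⟩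
  rw [ENNReal.ofReal_add (by positivity) (by positivity)]
  refine (measure_mono ((linesCaughtBy_mono hA).trans
    (h.linesCaughtBy_biUnion_subset S))).trans ((measure_union_le _ _).trans (add_le_add ?_ ?_))
  · exact (measure_biUnion_finset_le _ _).trans ((Finset.sum_le_sum_of_subset hS).trans
      (hσ.sum_kinematicMeasure_linesCaughtBy_polygonArc_le h hne hN))
  · refine (measure_biUnion_finset_le _ _).trans (hpairs.trans ?_)
    gcongr

lemma minEnergy_natCast_mul_add_le (h : IsConvexDomain Ω) (hne : Ω.Nonempty) (hr : 0 ≤ r)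
    (hrP : r < boundaryLength Ω) :
    minEnergy Ω (n * boundaryLength Ω + r) ≤ ENNReal.ofReal
      (2 * n ^ 2 * boundaryLength Ω + (4 * n + 1) * r + r ^ 2 / boundaryLength Ω) := by
  have hP := h.boundaryLength_pos hne
  set P := boundaryLength Ω
  have hlim : Tendsto (fun N : ℕ => ENNReal.ofReal (2 * n ^ 2 * P + (4 * n + 1) * r +
      (8 * Real.pi * (P / N) + 2 * P * (r / P + 1 / N) ^ 2) / 2)) atTop
      (𝓝 (ENNReal.ofReal (2 * n ^ 2 * P + (4 * n + 1) * r + r ^ 2 / P))) := by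
    have hinv (c : ℝ) := tendsto_const_div_atTop_nhds_zero_nat c
    have hsum := (((hinv P).const_mul (8 * Real.pi)).add
      ((((hinv 1).const_add (r / P)).pow 2).const_mul (2 * P))).div_const 2
    refine ENNReal.tendsto_ofReal ((hsum.const_add _).trans_eq ?_)
    congr 2
    field_simp
    ring
  refine ge_of_tendsto hlim ((eventually_gt_atTop 0).mono fun N hN => ?_)
  obtain ⟨A, hA, hAm, hAr, hcaught⟩ :=
    h.exists_subset_frontier_kinematicMeasure_linesCaughtBy_le hne hr hrP hN
  have hcomp := h.isCompetitor_copiesWith hne n (hA.trans frontier_subset_closure)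
    ((h.isOneRectifiable_frontier hne).mono hA hAm.nullMeasurableSet) hr hAr
  refine (iInf₂_le _ hcomp).trans ?_
  rw [h.croftonEnergy_copiesWith_of_subset_frontier hne n hA hAm hr hAr,
    ENNReal.ofReal_add (q := _ / 2) (by positivity) (by positivity),
    ENNReal.ofReal_div_of_pos two_pos,
    ENNReal.ofReal_ofNat]
  gcongr

lemma minEnergy_le (h : IsConvexDomain Ω) (hne : Ω.Nonempty) (hL : 0 ≤ L) :
    minEnergy Ω L ≤ ENNReal.ofReal (2 * L ^ 2 / boundaryLength Ω + boundaryLength Ω / 4) := by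
  have hP := h.boundaryLength_pos hne
  set P := boundaryLength Ω with hPdef
  have hfloor := (le_div_iff₀ hP).1 (Nat.floor_le (div_nonneg hL hP.le))
  have hlt := (div_lt_iff₀ hP).1 (Nat.lt_floor_add_one (L / P))
  obtain ⟨r, hr⟩ : ∃ r, L = ⌊L / P⌋₊ * P + r := ⟨_, (add_sub_cancel _ L).symm⟩
  generalize ⌊L / P⌋₊ = n at *
  subst hr
  refine (h.minEnergy_natCast_mul_add_le hne (by linarith) (by linarith)).trans
    (ENNReal.ofReal_le_ofReal ?_)
  rw [← hPdef, ← sub_nonneg]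
  calc (0 : ℝ) ≤ (r - P / 2) ^ 2 / P := by positivity
    _ = _ := by field_simp; ring

end IsConvexDomain

/-! ### Minimal energy -/

/-- The lower bound for the minimal energy at length `L` when the boundary has length `P`: the
piecewise linear interpolation of `2 * L ^ 2 / P` at the multiples of `P / 2`, see
`interpolatedEnergy_eq`. -/
noncomputable def interpolatedEnergy (P L : ℝ) : ℝ :=
  2 * L ^ 2 / P + P / 2 * Int.fract (2 * L / P) * (1 - Int.fract (2 * L / P))

lemma interpolatedEnergy_nonneg {P : ℝ} (hP : 0 ≤ P) (L : ℝ) : 0 ≤ interpolatedEnergy P L :=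
  add_nonneg (by positivity) (mul_nonneg (mul_nonneg (by positivity) (Int.fract_nonneg _))
    (sub_nonneg.2 (Int.fract_lt_one _).le))

lemma interpolatedEnergy_eq {P L : ℝ} (hP : 0 < P) {k : ℕ} (hkL : k * P ≤ 2 * L)
    (hLk : 2 * L ≤ (k + 1) * P) :
    interpolatedEnergy P L = (2 * k + 1) * L - k * (k + 1) * P / 2 := by
  rcases hLk.lt_or_eq with hlt | heq
  · have hfloor : ⌊2 * L / P⌋ = k :=
      Int.floor_eq_iff.2 ⟨by exact_mod_cast (le_div_iff₀ hP).2 hkL,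
        by exact_mod_cast (div_lt_iff₀ hP).2 hlt⟩
    rw [interpolatedEnergy, Int.fract, hfloor, Int.cast_natCast]
    field_simp
    ring
  · have hfract : Int.fract (2 * L / P) = 0 := by
      rw [heq, mul_div_cancel_right₀ _ hP.ne', ← Nat.cast_succ, Int.fract_natCast]
    obtain rfl : L = (k + 1) * P / 2 := by linarith
    rw [interpolatedEnergy, hfract]
    field_simp
    ring

namespace IsConvexDomain

variable {Ω : Set Plane} {L : ℝ} {a b : Plane}

lemma ofReal_interpolatedEnergy_le_minEnergy (h : IsConvexDomain Ω) (hne : Ω.Nonempty)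
    (hL : 0 ≤ L) : ENNReal.ofReal (interpolatedEnergy (boundaryLength Ω) L) ≤ minEnergy Ω L := by
  have hP := h.boundaryLength_pos hne
  refine le_iInf₂ fun θ hθ => ?_
  rw [interpolatedEnergy_eq hP ((le_div_iff₀ hP).1 (Nat.floor_le (by positivity)))
    ((div_lt_iff₀ hP).1 (Nat.lt_floor_add_one _)).le]
  exact h.ofReal_le_croftonEnergy hne hθ _

lemma croftonEnergy_copiesWithSegment_eq_interpolatedEnergy (h : IsConvexDomain Ω)
    (hne : Ω.Nonempty) (ha : a ∈ closure Ω) (hb : b ∈ closure Ω) (n : ℕ) :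
    croftonEnergy (copiesWithSegment Ω n a b) = ENNReal.ofReal
      (interpolatedEnergy (boundaryLength Ω) (n * boundaryLength Ω + dist a b)) := by
  have hchord := h.two_mul_dist_le_boundaryLength hne ha hb
  have hdist : 0 ≤ dist a b := dist_nonneg
  rw [interpolatedEnergy_eq (k := 2 * n) (h.boundaryLength_pos hne) (by push_cast; linarith)
    (by push_cast; linarith)]
  refine (h.croftonEnergy_copiesWith_segment hne n ha hb).trans (congrArg ENNReal.ofReal ?_)
  push_cast
  ring

lemma croftonEnergy_copiesWithSegment_eq_minEnergy (h : IsConvexDomain Ω) (hne : Ω.Nonempty)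
    (ha : a ∈ closure Ω) (hb : b ∈ closure Ω) (n : ℕ) :
    croftonEnergy (copiesWithSegment Ω n a b) =
      minEnergy Ω (n * boundaryLength Ω + dist a b) := by
  have hP := (h.boundaryLength_pos hne).le
  refine le_antisymm ?_ (iInf₂_le _ (h.isCompetitor_copiesWithSegment hne n ha hb))
  rw [h.croftonEnergy_copiesWithSegment_eq_interpolatedEnergy hne ha hb]
  exact h.ofReal_interpolatedEnergy_le_minEnergy hne (by positivity)

end IsConvexDomain

theorem theorem3_general (Ω : Set Plane) (hne : Ω.Nonempty) (hopen : IsOpen Ω)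
    (hbdd : Bornology.IsBounded Ω) (hconv : Convex ℝ Ω) (L : ℝ) (hL : 0 ≤ L) :
    minEnergy Ω L ≠ ⊤ ∧
    boundaryLength Ω / 2 * Int.fract (2 * L / boundaryLength Ω) *
        (1 - Int.fract (2 * L / boundaryLength Ω))
      ≤ (minEnergy Ω L).toReal - 2 * L ^ 2 / boundaryLength Ω ∧
    (minEnergy Ω L).toReal - 2 * L ^ 2 / boundaryLength Ω ≤ boundaryLength Ω / 4 ∧
    ∀ n : ℕ, n * boundaryLength Ω ≤ L → L ≤ n * boundaryLength Ω + Metric.diam Ω →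
      (minEnergy Ω L).toReal - 2 * L ^ 2 / boundaryLength Ω
        = boundaryLength Ω / 2 * Int.fract (2 * L / boundaryLength Ω) *
            (1 - Int.fract (2 * L / boundaryLength Ω)) ∧
      (∃ a ∈ closure Ω, ∃ b ∈ closure Ω, dist a b = L - n * boundaryLength Ω) ∧
      ∀ a ∈ closure Ω, ∀ b ∈ closure Ω, dist a b = L - n * boundaryLength Ω →
        IsCompetitor Ω L (copiesWithSegment Ω n a b) ∧
        croftonEnergy (copiesWithSegment Ω n a b) = minEnergy Ω L := by
  have h : IsConvexDomain Ω := ⟨hopen, hbdd, hconv⟩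
  have hP := h.boundaryLength_pos hne
  have hupper := h.minEnergy_le hne hL
  have hfin : minEnergy Ω L ≠ ⊤ := ne_top_of_le_ne_top ENNReal.ofReal_ne_top hupper
  have hlower := (ENNReal.ofReal_le_iff_le_toReal hfin).1
    (h.ofReal_interpolatedEnergy_le_minEnergy hne hL)
  refine ⟨hfin, le_sub_iff_add_le'.2 hlower, sub_le_iff_le_add'.2
    (ENNReal.toReal_le_of_le_ofReal (by positivity) hupper), fun n hn hnd => ?_⟩
  have hexists := h.exists_dist_eq hne (sub_nonneg.2 hn) (sub_le_iff_le_add'.2 hnd)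
  refine ⟨?_, hexists, fun a ha b hb hab => ?_⟩
  · obtain ⟨a, ha, b, hb, hab⟩ := hexists
    rw [eq_add_of_sub_eq' hab.symm, ← h.croftonEnergy_copiesWithSegment_eq_minEnergy hne ha hb,
      h.croftonEnergy_copiesWithSegment_eq_interpolatedEnergy hne ha hb,
      ENNReal.toReal_ofReal (interpolatedEnergy_nonneg hP.le _), interpolatedEnergy,
      add_sub_cancel_left]
  · rw [eq_add_of_sub_eq' hab.symm]
    exact ⟨h.isCompetitor_copiesWithSegment hne n ha hb,
      h.croftonEnergy_copiesWithSegment_eq_minEnergy hne ha hb n⟩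

theorem theorem3 (Ω : Set Plane) (hne : Ω.Nonempty) (hopen : IsOpen Ω)
    (hbdd : Bornology.IsBounded Ω) (hconv : Convex ℝ Ω) (hC1 : HasC1Boundary Ω)
    (L : ℝ) (hL : 0 ≤ L) :
    minEnergy Ω L ≠ ⊤ ∧
    boundaryLength Ω / 2 * Int.fract (2 * L / boundaryLength Ω) *
        (1 - Int.fract (2 * L / boundaryLength Ω))
      ≤ (minEnergy Ω L).toReal - 2 * L ^ 2 / boundaryLength Ω ∧
    (minEnergy Ω L).toReal - 2 * L ^ 2 / boundaryLength Ω ≤ boundaryLength Ω / 4 ∧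
    ∀ n : ℕ, n * boundaryLength Ω ≤ L → L ≤ n * boundaryLength Ω + Metric.diam Ω →
      (minEnergy Ω L).toReal - 2 * L ^ 2 / boundaryLength Ω
        = boundaryLength Ω / 2 * Int.fract (2 * L / boundaryLength Ω) *
            (1 - Int.fract (2 * L / boundaryLength Ω)) ∧
      (∃ a ∈ closure Ω, ∃ b ∈ closure Ω, dist a b = L - n * boundaryLength Ω) ∧
      ∀ a ∈ closure Ω, ∀ b ∈ closure Ω, dist a b = L - n * boundaryLength Ω →
        IsCompetitor Ω L (copiesWithSegment Ω n a b) ∧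
        croftonEnergy (copiesWithSegment Ω n a b) = minEnergy Ω L :=
  theorem3_general Ω hne hopen hbdd hconv L hL
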